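/- Call a (randomized) auction of $k$ identical units to $n$ unit-demand bidders with nonnegative valuations, with winning probabilities $X_i(v)$ ($\sum_i X_i\le k$) and expected payments $P_i(v)$, admissible if it is individually rational ($P_i(v)\le v_iX_i(v)$) and truthful (for all bids of the others, bidder $i$ maximizes $v_iX_i-P_i$ by bidding $v_i$). Its revenue on a valuation profile $v$ is $\sum_i P_i(v)$. Let $v^{(2)}$ be the second-highest valuation of $v$. For $k\ge 2$ the $k$-unit monotone price benchmark $\mathcal M^{(2,k)}(v)$ is the maximum revenue of a price vector with $v^{(2)}\ge p_1\ge p_2\ge\dots\ge p_n$ and at most $k$ bidders with $v_i>p_i$, where the revenue is $\sum_{i: v_i>p_i}p_i$ plus, if $\ell$ units remain, the sum of the prices of up to $\ell$ bidders (chosen optimally) with $v_i=p_i$. A Bayesian multi-unit environment consists of $n\ge 2$ bidders, $k\ge 2$ units, and independent valuations $v_i\sim\mathcal F_i$, where each $\mathcal F_i$ is a distribution of nonnegative reals with finite mean and with a positive continuous density $f_i$ on an interval. Let $\phi_i(v)=v-\frac{1-\mathcal F_i(v)}{f_i(v)}$ be the virtual value, and let the ironed virtual value $\bar\phi_i(v)$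 be the slope at $q=\mathcal F_i(v)$ of the greatest convex function on $[0,1]$ below $H_i(q)=\int_0^q\phi_i(\mathcal F_i^{-1}(r))\,dr$. For $z\ge0$ let $\bar\phi_i^{-1}(z)$ be the infimum of the inverse image of $z$; if it is empty, it is the left or the right endpoint of the support, according to whether the ironed virtual values are all above or all below $z$. The distributions are pointwise ordered if $\bar\phi_i^{-1}(z)$ is nonincreasing in $i$ for every $z\ge 0$. The Bayesian optimal auction $\mathcal A^*$ awards the units to the (at most $k$) bidders with the highest positive ironed virtual values, breaking ties uniformly at random (a bid below the support never wins); with $X_i^*$ its winning probabilities, bidder $i$'s expected payment is $P_i^*(v)=v_iX^*_i(v)-\int_0^{v_i}X^*_i(t,v_{-i})\,dt$, charged as the price $P_i^*(v)/X_i^*(v)$ when $i$ wins. For $\gamma<1$, the environment is $\gamma$-well-behaved if at most a $\gamma$ fraction of the expected revenue of $\mathcal A^*$ comes from outcomes in which some winner is charged a price higher than $v^{(2)}$. Theorem. For all $\alpha>0$ and $\gamma<1$ there is a constant $c>0$, depending only on $\alpha$ and $\gamma$, such that the following holds for all $n,k\ge2$. If $\mathcal A$ is an admissible auction with revenue at least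 $\alpha\,\mathcal M^{(2,k)}(v)$ on every valuation profile $v$, then, in every $\gamma$-well-behaved environment with $n$ bidders, $k$ units and pointwise ordered distributions, the expected revenue of $\mathcal A$ is at least $c$ times that of the optimal auction $\mathcal A^*$, and at least $c$ times that of every admissible auction. -/

import Mathlib

noncomputable section

namespace PriorFree

open MeasureTheory Set

/-! ### Multi-unit auctions -/

/-- A (randomized, direct-revelation) truthful and individually rational auction of `k` identical
units to `n` unit-demand bidders. `X v i` and `P v i` are the winning probability and the expected
payment of bidder `i` at the bid profile `v`. Valuations and bids are nonnegative reals, so every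
requirement concerns nonnegative profiles only. -/
structure Auction (n k : ℕ) where
  X : (Fin n → ℝ) → Fin n → ℝ
  P : (Fin n → ℝ) → Fin n → ℝ
  measurable_X : ∀ i, Measurable fun v => X v i
  measurable_P : ∀ i, Measurable fun v => P v i
  X_nonneg : ∀ v, (∀ j, 0 ≤ v j) → ∀ i, 0 ≤ X v i
  X_le_one : ∀ v, (∀ j, 0 ≤ v j) → ∀ i, X v i ≤ 1
  /-- At most `k` units are sold. -/
  supply : ∀ v, (∀ j, 0 ≤ v j) → ∑ i, X v i ≤ k
  /-- Individual rationality. -/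
  rational : ∀ v, (∀ j, 0 ≤ v j) → ∀ i, P v i ≤ v i * X v i
  /-- Bidding one's own valuation maximizes the quasi-linear utility. -/
  truthful : ∀ v, (∀ j, 0 ≤ v j) → ∀ i, ∀ b : ℝ, 0 ≤ b →
    v i * X (Function.update v i b) i - P (Function.update v i b) i ≤ v i * X v i - P v i

/-- The (expected) revenue of an auction on the valuation profile `v`. -/
def Auction.revenue {n k : ℕ} (A : Auction n k) (v : Fin n → ℝ) : ℝ := ∑ i, A.P v i

/-! ### The `k`-unit monotone price benchmark -/

/-- The second-highest valuation of a profile of at least two bidders, counted with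
multiplicity: the largest value of `min (v i) (v j)` over pairs of distinct bidders. -/
def secondHighest {n : ℕ} (v : Fin n → ℝ) : ℝ :=
  sSup {x | ∃ i j, i ≠ j ∧ x = min (v i) (v j)}

/-- Feasible price vectors: nonincreasing in the bidder index, at most the second-highest
valuation, and with at most `k` bidders strictly above their price. -/
def FeasiblePrices {n : ℕ} (k : ℕ) (v p : Fin n → ℝ) : Prop :=
  (∀ i j, i ≤ j → p j ≤ p i) ∧ (∀ i, p i ≤ secondHighest v) ∧
    (Finset.univ.filter fun i => p i < v i).card ≤ k

/-- The benchmark `M^(2,k)(v)`: the best revenue of a feasible price vector. All bidders strictly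
above their price buy; the units that remain may be sold to any set `D` of bidders whose valuation
equals their price. -/
def benchmark {n : ℕ} (k : ℕ) (v : Fin n → ℝ) : ℝ :=
  sSup {r | ∃ p : Fin n → ℝ, FeasiblePrices k v p ∧ ∃ D : Finset (Fin n),
    (∀ i ∈ D, v i = p i) ∧ (Finset.univ.filter fun i => p i < v i).card + D.card ≤ k ∧
    r = ∑ i ∈ Finset.univ.filter (fun i => p i < v i), p i + ∑ i ∈ D, p i}

/-! ### Valuation distributions and ironed virtual values -/

/-- The open interval with real left endpoint `lo` and possibly infinite right endpoint `hi`. -/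
def interval (lo : ℝ) (hi : EReal) : Set ℝ := {v | lo < v ∧ (v : EReal) < hi}

/-- A distribution of nonnegative valuations with finite mean and with a positive and continuous
density on an interval. Whether the endpoints belong to the interval does not change the
distribution, so the interval is taken to be open; the values of `density` off it are not used. -/
structure ValueDist where
  lo : ℝ
  hi : EReal
  density : ℝ → ℝ
  lo_nonneg : 0 ≤ lo
  density_pos : ∀ v ∈ interval lo hi, 0 < density v
  density_continuousOn : ContinuousOn density (interval lo hi)
  integral_density : ∫ v in interval lo hi, density v = 1
  finite_mean : IntegrableOn (fun v => v * density v) (interval lo hi)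

namespace ValueDist

/-- The (interior of the) support. -/
def supp (F : ValueDist) : Set ℝ := interval F.lo F.hi

/-- The law of the valuation. -/
def law (F : ValueDist) : Measure ℝ :=
  (volume.restrict F.supp).withDensity fun v => ENNReal.ofReal (F.density v)

/-- The distribution function. -/
def cdf (F : ValueDist) (v : ℝ) : ℝ := F.law.real (Iic v)

/-- The virtual value of a point of the support. -/
def virtualValue (F : ValueDist) (v : ℝ) : ℝ := v - (1 - F.cdf v) / F.density v

/-- The virtual value accumulated up to quantile `q`, that is, the integral over `[0, q]` of the
virtual value at the quantiles of the distribution. -/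
def cumVirtual (F : ValueDist) (q : ℝ) : ℝ := ∫ v in {v | F.cdf v ≤ q}, F.virtualValue v ∂F.law

/-- The greatest convex function on `[0, 1]` that lies below `cumVirtual`. -/
def convexHull (F : ValueDist) (q : ℝ) : ℝ :=
  sSup {y | ∃ g : ℝ → ℝ, ConvexOn ℝ (Icc 0 1) g ∧ (∀ x ∈ Icc (0 : ℝ) 1, g x ≤ F.cumVirtual x) ∧
    y = g q}

/-- The ironed virtual value of a point of the support: the slope of the convex hull at the
point's quantile. -/
def ironed (F : ValueDist) (v : ℝ) : ℝ :=
  derivWithin F.convexHull (Ioi (F.cdf v)) (F.cdf v)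

open Classical in
/-- The inverse of the ironed virtual value: the infimum of the inverse image of `z`, and if that
is empty, the left endpoint of the support if all ironed virtual values are above `z`, and the
right endpoint if they are below. -/
def ironedInv (F : ValueDist) (z : ℝ) : EReal :=
  if ∃ v ∈ F.supp, F.ironed v = z then
    sInf ((fun v : ℝ => (v : EReal)) '' {v | v ∈ F.supp ∧ F.ironed v = z})
  else if ∀ v ∈ F.supp, z < F.ironed v then (F.lo : EReal) else F.hi

/-- The ironed virtual value assigned to an arbitrary bid `t`: it is `ironed t` on the support,
`⊥` (so that the bidder loses) below it, and the supremum of all ironed virtual values above it. -/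
def bidLevel (F : ValueDist) (t : ℝ) : EReal :=
  ⨆ x ∈ {x | x ∈ F.supp ∧ x ≤ t}, (F.ironed x : EReal)

end ValueDist

/-- Pointwise ordered distributions. -/
def PointwiseOrdered {n : ℕ} (F : Fin n → ValueDist) : Prop :=
  ∀ z : ℝ, 0 ≤ z → ∀ i j, i ≤ j → (F j).ironedInv z ≤ (F i).ironedInv z

/-! ### Bayesian multi-unit environments -/

/-- Valuations are drawn independently, `v i` from `F i`. -/
def priorLaw {n : ℕ} (F : Fin n → ValueDist) : Measure (Fin n → ℝ) :=
  Measure.pi fun i => (F i).law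

/-- The expected revenue of an auction in the Bayesian environment. -/
def expectedRevenue {n k : ℕ} (F : Fin n → ValueDist) (A : Auction n k) : ℝ :=
  ∫ v, A.revenue v ∂priorLaw F

open Classical in
/-- The possible winner sets of the Bayesian optimal auction: the (at most `k`) bidders with the
highest positive ironed virtual values. Ties are broken randomly: the winner set is uniformly
distributed over the elements of `winnerSets`. -/
def winnerSets {n : ℕ} (F : Fin n → ValueDist) (k : ℕ) (v : Fin n → ℝ) :
    Finset (Finset (Fin n)) :=
  Finset.univ.filter fun W =>
    (∀ i ∈ W, 0 < (F i).bidLevel (v i)) ∧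
    W.card = min k (Finset.univ.filter fun i => 0 < (F i).bidLevel (v i)).card ∧
    ∀ i ∈ W, ∀ j ∉ W, (F j).bidLevel (v j) ≤ (F i).bidLevel (v i)

/-- The winning probabilities of the Bayesian optimal auction. -/
def optX {n : ℕ} (F : Fin n → ValueDist) (k : ℕ) (v : Fin n → ℝ) (i : Fin n) : ℝ :=
  ((winnerSets F k v).filter fun W => i ∈ W).card / (winnerSets F k v).card

/-- The expected payments of the Bayesian optimal auction, by the payment formula for
incentive-compatible auctions. -/
def optP {n : ℕ} (F : Fin n → ValueDist) (k : ℕ) (v : Fin n → ℝ) (i : Fin n) : ℝ :=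
  v i * optX F k v i - ∫ t in (0 : ℝ)..(v i), optX F k (Function.update v i t) i

/-- The price charged to bidder `i` in the Bayesian optimal auction in the event that it wins. -/
def optPrice {n : ℕ} (F : Fin n → ValueDist) (k : ℕ) (v : Fin n → ℝ) (i : Fin n) : ℝ :=
  optP F k v i / optX F k v i

/-- The expected revenue of the Bayesian optimal auction. -/
def optRevenue {n : ℕ} (F : Fin n → ValueDist) (k : ℕ) : ℝ :=
  ∫ v, ∑ i, optP F k v i ∂priorLaw F

open Classical in
/-- The part of the expected revenue of the Bayesian optimal auction that comes from outcomes
(a valuation profile `v` and a winner set `W`) in which some winner is charged a price higher than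
the second-highest valuation. -/
def optHighPriceRevenue {n : ℕ} (F : Fin n → ValueDist) (k : ℕ) : ℝ :=
  ∫ v, (∑ W ∈ (winnerSets F k v).filter
      (fun W => ∃ i ∈ W, secondHighest v < optPrice F k v i), ∑ i ∈ W, optPrice F k v i) /
    ((winnerSets F k v).card : ℝ) ∂priorLaw F

/-- A well-behaved environment: at most a fraction `γ` of the revenue of the Bayesian optimal
auction comes from outcomes in which some winner is charged more than the second-highest
valuation. -/
def WellBehaved {n : ℕ} (γ : ℝ) (F : Fin n → ValueDist) (k : ℕ) : Prop :=
  optHighPriceRevenue F k ≤ γ * optRevenue F k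

end PriorFree

end

noncomputable section

namespace PriorFree

open MeasureTheory Set Filter Topology

/-! Fix a profile in the supports and a winner set `W` of the optimal auction in which nobody is
charged more than the second-highest valuation. Its members fall into two groups: those who win
whatever the tie-breaking, and those who win only by lottery, who all share one ironed virtual
value. Let `y` be the lowest ironed virtual value in a group. A member keeps its winning probability
when it lowers its bid to any point of level at least `y` (`share_update_eq_one` for sure winners;
for lottery winners the level does not even change), so its price is at most its `ironedInv y`. By
the pointwise order these thresholds, capped at the second-highest valuation, are monotone prices,
and each member of the group can afford its own. Even if more than `k` bidders can afford such
prices, the benchmark collects at least what the group pays (`sum_le_benchmark`). Hence each group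
pays at most the benchmark, and `W` at most twice the benchmark (`sum_winners_optPrice_le`). A
well-behaved environment leaves at least a fraction `1 - γ` of the optimal revenue to such outcomes,
which gives the constant `α * (1 - γ) / 2`.

The comparison with arbitrary auctions is Myerson's theorem with ironing
(`expectedRevenue_le_optRevenue`). With the other bids fixed, `gap` is the ironed virtual surplus of
a bidder minus its payment. For a posted price inside the support it integrates to `cumVirtual -
convexHull` at the quantile of the price. This is nonnegative, and it is zero if the rule does not
separate points of equal ironed virtual value, because the hull is affine wherever it lies strictly
below `cumVirtual`. Monotone rules are uniform limits of mixtures of threshold rules, so both facts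
pass to them. The optimal auction has zero gap and maximizes the ironed virtual surplus on every
profile in the supports. -/

/-! ### The greatest convex minorant on the unit interval -/

/-- The greatest convex function on `[0, 1]` below `H`. -/
def convexMinorant (H : ℝ → ℝ) (q : ℝ) : ℝ :=
  sSup {y | ∃ g : ℝ → ℝ, ConvexOn ℝ (Icc 0 1) g ∧ (∀ x ∈ Icc (0 : ℝ) 1, g x ≤ H x) ∧ y = g q}

section Minorant

variable {H : ℝ → ℝ} {q : ℝ}

theorem le_convexMinorant {g : ℝ → ℝ} (hg : ConvexOn ℝ (Icc 0 1) g)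
    (hgH : ∀ x ∈ Icc (0 : ℝ) 1, g x ≤ H x) (hq : q ∈ Icc (0 : ℝ) 1) :
    g q ≤ convexMinorant H q := by
  refine le_csSup ⟨H q, ?_⟩ ⟨g, hg, hgH, rfl⟩
  rintro y ⟨g', -, h, rfl⟩
  exact h q hq

theorem convexMinorant_set_nonempty (hH : ContinuousOn H (Icc 0 1)) (q : ℝ) :
    {y | ∃ g : ℝ → ℝ, ConvexOn ℝ (Icc 0 1) g ∧ (∀ x ∈ Icc (0 : ℝ) 1, g x ≤ H x) ∧
      y = g q}.Nonempty := by
  obtain ⟨C, hC⟩ := (isCompact_Icc.image_of_continuousOn hH).bddBelow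
  exact ⟨C, fun _ => C, convexOn_const _ (convex_Icc _ _), fun x hx => hC ⟨x, hx, rfl⟩, rfl⟩

theorem convexMinorant_le (hH : ContinuousOn H (Icc 0 1)) (hq : q ∈ Icc (0 : ℝ) 1) :
    convexMinorant H q ≤ H q := by
  refine csSup_le (convexMinorant_set_nonempty hH q) ?_
  rintro y ⟨g', -, h, rfl⟩
  exact h q hq

theorem convexOn_convexMinorant (hH : ContinuousOn H (Icc 0 1)) :
    ConvexOn ℝ (Icc 0 1) (convexMinorant H) := by
  refine ⟨convex_Icc _ _, fun x hx y hy a b ha hb hab => ?_⟩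
  refine csSup_le (convexMinorant_set_nonempty hH _) ?_
  rintro _ ⟨g, hg, hgH, rfl⟩
  refine (hg.2 hx hy ha hb hab).trans ?_
  have h1 := le_convexMinorant hg hgH hx
  have h2 := le_convexMinorant hg hgH hy
  simp only [smul_eq_mul]
  gcongr

theorem convexOn_affine (c m p : ℝ) (s : Set ℝ) (hs : Convex ℝ s) :
    ConvexOn ℝ s fun x => c + m * (x - p) := by
  refine ⟨hs, fun x _ y _ a b _ _ hab => le_of_eq ?_⟩
  have : b = 1 - a := by linarith
  subst this
  simp only [smul_eq_mul]
  ring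

/-- Near `p` continuity suffices; farther than `δ` away the slope `(H p - B) / δ` has already pushed
the cone below the lower bound `B` of `H`. -/
theorem exists_sub_mul_dist_le (hH : ContinuousOn H (Icc 0 1)) {p : ℝ} (hp : p ∈ Icc (0 : ℝ) 1)
    {ε : ℝ} (hε : 0 < ε) :
    ∃ C, 0 ≤ C ∧ ∀ x ∈ Icc (0 : ℝ) 1, H p - ε - C * |x - p| ≤ H x := by
  obtain ⟨B, hB⟩ := (isCompact_Icc.image_of_continuousOn hH).bddBelow
  have hB' : ∀ x ∈ Icc (0 : ℝ) 1, B ≤ H x := fun x hx => hB ⟨x, hx, rfl⟩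
  obtain ⟨δ, hδ, h⟩ := Metric.continuousWithinAt_iff.1 (hH p hp) ε hε
  have hBp := hB' p hp
  refine ⟨(H p - B) / δ, div_nonneg (by linarith) hδ.le, fun x hx => ?_⟩
  by_cases hxp : dist x p < δ
  · have h1 := h hx hxp
    rw [Real.dist_eq] at h1
    have h2 := (abs_lt.1 h1).1
    have h3 : 0 ≤ (H p - B) / δ * |x - p| :=
      mul_nonneg (div_nonneg (by linarith) hδ.le) (abs_nonneg _)
    linarith
  · have h1 : δ ≤ |x - p| := by rw [← Real.dist_eq]; exact not_lt.1 hxp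
    have h2 : H p - B ≤ (H p - B) / δ * |x - p| := by
      rw [div_mul_eq_mul_div, le_div_iff₀ hδ]
      exact mul_le_mul_of_nonneg_left h1 (by linarith)
    linarith [hB' x hx]

/-- At an endpoint of `[0, 1]` the function `|x - p|` is affine, so the cone is itself a convex
competitor below `H`. This yields the value and the continuity of the minorant at the endpoints,
which convexity alone does not give. -/
theorem exists_sub_mul_dist_le_convexMinorant (hH : ContinuousOn H (Icc 0 1)) {p : ℝ}
    (hp : p = 0 ∨ p = 1) {ε : ℝ} (hε : 0 < ε) :
    ∃ C, 0 ≤ C ∧ ∀ x ∈ Icc (0 : ℝ) 1, H p - ε - C * |x - p| ≤ convexMinorant H x := by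
  have hpI : p ∈ Icc (0 : ℝ) 1 := by rcases hp with rfl | rfl <;> simp
  obtain ⟨C, hC, h⟩ := exists_sub_mul_dist_le hH hpI hε
  refine ⟨C, hC, fun x hx => ?_⟩
  rcases hp with rfl | rfl
  · have := le_convexMinorant (H := H) (convexOn_affine (H 0 - ε) (-C) 0 _ (convex_Icc 0 1))
      (fun y hy => by
        have := h y hy
        rw [abs_of_nonneg (by linarith [hy.1])] at this
        linarith) hx
    rw [abs_of_nonneg (by linarith [hx.1])]
    linarith
  · have := le_convexMinorant (H := H) (convexOn_affine (H 1 - ε) C 1 _ (convex_Icc 0 1))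
      (fun y hy => by
        have := h y hy
        rw [abs_of_nonpos (by linarith [hy.2])] at this
        linarith) hx
    rw [abs_of_nonpos (by linarith [hx.2])]
    linarith

theorem convexMinorant_endpoint (hH : ContinuousOn H (Icc 0 1)) {p : ℝ} (hp : p = 0 ∨ p = 1) :
    convexMinorant H p = H p := by
  have hpI : p ∈ Icc (0 : ℝ) 1 := by rcases hp with rfl | rfl <;> simp
  refine le_antisymm (convexMinorant_le hH hpI) (le_of_forall_pos_sub_le fun ε hε => ?_)
  obtain ⟨C, -, h⟩ := exists_sub_mul_dist_le_convexMinorant hH hp hε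
  simpa using h p hpI

theorem continuousOn_convexMinorant (hH : ContinuousOn H (Icc 0 1)) :
    ContinuousOn (convexMinorant H) (Icc 0 1) := by
  have key : ∀ p : ℝ, p = 0 ∨ p = 1 → ContinuousWithinAt (convexMinorant H) (Icc 0 1) p := by
    intro p hp
    have hpI : p ∈ Icc (0 : ℝ) 1 := by rcases hp with rfl | rfl <;> simp
    have heq := convexMinorant_endpoint hH hp
    refine tendsto_order.2 ⟨fun a ha => ?_, fun a ha => ?_⟩
    · rw [heq] at ha
      obtain ⟨C, -, h⟩ := exists_sub_mul_dist_le_convexMinorant hH hp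
        (show 0 < (H p - a) / 2 by linarith)
      have hc : Tendsto (fun x => H p - (H p - a) / 2 - C * |x - p|) (𝓝[Icc 0 1] p)
          (𝓝 (H p - (H p - a) / 2 - C * |p - p|)) :=
        Continuous.continuousWithinAt (by fun_prop)
      have := (tendsto_order.1 hc).1 a (by simp; linarith)
      filter_upwards [this, self_mem_nhdsWithin] with x h1 h2
      exact h1.trans_le (h x h2)
    · rw [heq] at ha
      filter_upwards [(tendsto_order.1 (hH p hpI)).2 a ha, self_mem_nhdsWithin] with x h1 h2
      exact (convexMinorant_le hH h2).trans_lt h1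
  intro x hx
  rcases hx.1.eq_or_lt with h0 | h0
  · exact key x (Or.inl h0.symm)
  rcases hx.2.eq_or_lt with h1 | h1
  · exact key x (Or.inr h1)
  have := (convexOn_convexMinorant hH).continuousOn_interior
  rw [interior_Icc] at this
  exact (this.continuousAt (Ioo_mem_nhds h0 h1)).continuousWithinAt

/-- On a small interval around `q` a constant `c` separates the minorant from `H`. The chord of the
minorant is at most `c` inside the interval and below the minorant outside it, so the maximum of
minorant and chord is again a convex competitor. Maximality makes the chord a lower bound, convexity
an upper bound. -/
theorem convexMinorant_affine_near (hH : ContinuousOn H (Icc 0 1)) (hq : q ∈ Ioo (0 : ℝ) 1)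
    (hlt : convexMinorant H q < H q) :
    ∃ m, ∀ᶠ x in 𝓝 q, convexMinorant H x = convexMinorant H q + m * (x - q) := by
  set G := convexMinorant H with hG
  have hI : Icc (0 : ℝ) 1 ∈ 𝓝 q := Icc_mem_nhds hq.1 hq.2
  have hGc : ContinuousAt G q := (continuousOn_convexMinorant hH).continuousAt hI
  have hHc : ContinuousAt H q := hH.continuousAt hI
  obtain ⟨c, hc1, hc2⟩ := exists_between hlt
  have hev : ∀ᶠ x in 𝓝 q, G x < c ∧ c < H x ∧ x ∈ Icc (0 : ℝ) 1 :=
    (hGc.eventually_lt_const hc1).and ((hHc.eventually_const_lt hc2).and hI)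
  obtain ⟨δ, hδ, hb⟩ := Metric.eventually_nhds_iff.1 hev
  obtain ⟨a, ha⟩ : ∃ a, a = q - δ / 2 := ⟨_, rfl⟩
  obtain ⟨b, hb'⟩ : ∃ b, b = q + δ / 2 := ⟨_, rfl⟩
  have hab : a < b := by linarith
  have hmem : ∀ x ∈ Icc a b, G x < c ∧ c < H x ∧ x ∈ Icc (0 : ℝ) 1 := by
    intro x hx
    apply hb
    rw [Real.dist_eq, abs_lt]
    constructor <;> linarith [hx.1, hx.2]
  obtain ⟨hGa, -, haI⟩ := hmem a ⟨le_rfl, hab.le⟩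
  obtain ⟨hGb, -, hbI⟩ := hmem b ⟨hab.le, le_rfl⟩
  set m := (G b - G a) / (b - a) with hm
  have hmul : m * (b - a) = G b - G a := div_mul_cancel₀ _ (by linarith)
  have hconv := convexOn_convexMinorant hH
  have hin : ∀ x ∈ Icc a b, G x ≤ G a + m * (x - a) := by
    intro x hx
    rcases hx.1.eq_or_lt with h | h
    · subst h; simp
    rcases hx.2.eq_or_lt with h' | h'
    · subst h'; linarith
    have := hconv.secant_mono_aux1 haI hbI h h'
    have h2 : (b - a) * G x ≤ (b - a) * (G a + m * (x - a)) := by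
      calc (b - a) * G x ≤ (b - x) * G a + (x - a) * G b := this
        _ = (b - a) * G a + (G b - G a) * (x - a) := by ring
        _ = (b - a) * (G a + m * (x - a)) := by rw [← hmul]; ring
    exact le_of_mul_le_mul_left h2 (by linarith)
  have hout : ∀ x ∈ Icc (0 : ℝ) 1, x ∉ Icc a b → G a + m * (x - a) ≤ G x := by
    intro x hx hxab
    by_cases hxa : x < a
    · have := hconv.secant_mono_aux1 hx hbI hxa hab
      have h2 : (b - a) * (G a + m * (x - a)) ≤ (b - a) * G x := by
        have : (b - a) * (G a + m * (x - a)) = (b - a) * G a + (G b - G a) * (x - a) := by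
          rw [← hmul]; ring
        rw [this]; linarith
      exact le_of_mul_le_mul_left h2 (by linarith)
    · have hxb : b < x := by
        by_contra h
        exact hxab ⟨not_lt.1 hxa, not_lt.1 h⟩
      have := hconv.secant_mono_aux1 haI hx hab hxb
      have h2 : (b - a) * (G a + m * (x - a)) ≤ (b - a) * G x := by
        have : (b - a) * (G a + m * (x - a)) = (b - a) * G a + (G b - G a) * (x - a) := by
          rw [← hmul]; ring
        rw [this]; linarith
      exact le_of_mul_le_mul_left h2 (by linarith)
  have hlin : ∀ x ∈ Icc a b, G a + m * (x - a) ≤ c := by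
    intro x hx
    have h1 : (b - a) * (G a + m * (x - a)) = (b - x) * G a + (x - a) * G b := by
      have : (b - a) * (G a + m * (x - a)) = (b - a) * G a + (G b - G a) * (x - a) := by
        rw [← hmul]; ring
      rw [this]; ring
    have h2 : (b - x) * G a + (x - a) * G b ≤ (b - x) * c + (x - a) * c :=
      add_le_add (mul_le_mul_of_nonneg_left hGa.le (by linarith [hx.2]))
        (mul_le_mul_of_nonneg_left hGb.le (by linarith [hx.1]))
    have h3 : (b - a) * (G a + m * (x - a)) ≤ (b - a) * c := by rw [h1]; linarith
    exact le_of_mul_le_mul_left h3 (by linarith)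
  have hle : ∀ x ∈ Icc (0 : ℝ) 1, G a + m * (x - a) ≤ G x := by
    intro x hx
    have hsup := hconv.sup (convexOn_affine (G a) m a _ (convex_Icc 0 1))
    have := le_convexMinorant (H := H) hsup (fun y hy => by
      refine sup_le (convexMinorant_le hH hy) ?_
      by_cases hyab : y ∈ Icc a b
      · exact (hlin y hyab).trans (hmem y hyab).2.1.le
      · exact (hout y hy hyab).trans (convexMinorant_le hH hy)) hx
    exact le_sup_right.trans this
  have heq : ∀ x ∈ Icc a b, G x = G a + m * (x - a) := fun x hx =>
    le_antisymm (hin x hx) (hle x (hmem x hx).2.2)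
  refine ⟨m, ?_⟩
  filter_upwards [Icc_mem_nhds (show a < q by linarith) (show q < b by linarith)] with x hx
  rw [heq x hx, heq q ⟨by linarith, by linarith⟩]
  ring

/-- Where the minorant is not locally affine it touches `H`. Comparing difference quotients there
gives right derivative ≤ `d` ≤ left derivative, and convexity gives the reverse order. -/
theorem exists_hasDerivAt_convexMinorant (hH : ContinuousOn H (Icc 0 1)) (hq : q ∈ Ioo (0 : ℝ) 1)
    {d : ℝ} (hd : HasDerivAt H d q) : ∃ d', HasDerivAt (convexMinorant H) d' q := by
  have hI : Icc (0 : ℝ) 1 ∈ 𝓝 q := Icc_mem_nhds hq.1 hq.2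
  have hqI : q ∈ Icc (0 : ℝ) 1 := mem_of_mem_nhds hI
  rcases (convexMinorant_le hH hqI).lt_or_eq with hlt | heq
  · obtain ⟨m, hm⟩ := convexMinorant_affine_near hH hq hlt
    refine ⟨m, HasDerivAt.congr_of_eventuallyEq ?_ hm⟩
    have := (((hasDerivAt_id q).sub_const q).const_mul m).const_add (convexMinorant H q)
    simpa using this
  · have hconv := convexOn_convexMinorant hH
    have hint : q ∈ interior (Icc (0 : ℝ) 1) := by rwa [interior_Icc]
    have hr := hconv.hasDerivWithinAt_rightDeriv_of_mem_interior hint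
    have hl := hconv.hasDerivWithinAt_leftDeriv_of_mem_interior hint
    have hlr := hconv.leftDeriv_le_rightDeriv_of_mem_interior hint
    set r := derivWithin (convexMinorant H) (Ioi q) q
    set l := derivWithin (convexMinorant H) (Iio q) q
    have hrd : r ≤ d := by
      have h1 := (hasDerivWithinAt_iff_tendsto_slope' (notMem_Ioi.2 le_rfl)).1 hr
      have h2 := (hasDerivWithinAt_iff_tendsto_slope' (notMem_Ioi.2 le_rfl)).1
        (hd.hasDerivWithinAt (s := Ioi q))
      refine le_of_tendsto_of_tendsto h1 h2 ?_
      filter_upwards [self_mem_nhdsWithin, nhdsWithin_le_nhds hI] with x hx hxI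
      rw [slope_def_field, slope_def_field, heq]
      exact div_le_div_of_nonneg_right (sub_le_sub_right (convexMinorant_le hH hxI) _)
        (sub_nonneg.2 (le_of_lt hx))
    have hld : d ≤ l := by
      have h1 := (hasDerivWithinAt_iff_tendsto_slope' (notMem_Iio.2 le_rfl)).1 hl
      have h2 := (hasDerivWithinAt_iff_tendsto_slope' (notMem_Iio.2 le_rfl)).1
        (hd.hasDerivWithinAt (s := Iio q))
      refine le_of_tendsto_of_tendsto h2 h1 ?_
      filter_upwards [self_mem_nhdsWithin, nhdsWithin_le_nhds hI] with x hx hxI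
      rw [slope_def_field, slope_def_field, heq]
      exact div_le_div_of_nonpos_of_le (sub_nonpos.2 (le_of_lt hx))
        (sub_le_sub_right (convexMinorant_le hH hxI) _)
    have hl' : l = d := le_antisymm (hlr.trans hrd) hld
    have hr' : r = d := le_antisymm hrd (hld.trans hlr)
    rw [hr'] at hr
    rw [hl'] at hl
    refine ⟨d, ?_⟩
    have hu := hl.Iic_of_Iio.union hr.Ici_of_Ioi
    rwa [Iic_union_Ici, hasDerivWithinAt_univ] at hu

end Minorant

namespace ValueDist

variable (F : ValueDist)

/-! ### The law and the distribution function -/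

theorem isOpen_supp : IsOpen F.supp :=
  (isOpen_lt continuous_const continuous_id).inter
    (isOpen_lt continuous_coe_real_ereal continuous_const)

theorem measurableSet_supp : MeasurableSet F.supp := F.isOpen_supp.measurableSet

theorem ordConnected_supp : F.supp.OrdConnected :=
  ⟨fun _ hx _ hy _ hz => ⟨hx.1.trans_le hz.1, (EReal.coe_le_coe_iff.2 hz.2).trans_lt hy.2⟩⟩

variable {F} in
theorem pos_of_mem_supp {v : ℝ} (hv : v ∈ F.supp) : 0 < v := F.lo_nonneg.trans_lt hv.1

variable {F} in
theorem Ioc_lo_subset_supp {t : ℝ} (ht : t ∈ F.supp) : Ioc F.lo t ⊆ F.supp := fun _ hv =>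
  ⟨hv.1, (EReal.coe_le_coe_iff.2 hv.2).trans_lt ht.2⟩

variable {F} in
theorem exists_lt_mem_supp {t : ℝ} (ht : t ∈ F.supp) : ∃ s ∈ F.supp, s < t := by
  obtain ⟨s, h1, h2⟩ := exists_between ht.1
  exact ⟨s, Ioc_lo_subset_supp ht ⟨h1, h2.le⟩, h2⟩

variable {F} in
theorem eventually_mem_supp {t : ℝ} (ht : t ∈ F.supp) : ∀ᶠ x in 𝓝 t, x ∈ F.supp :=
  F.isOpen_supp.mem_nhds ht

variable {F} in
theorem exists_gt_mem_supp {t : ℝ} (ht : t ∈ F.supp) : ∃ s ∈ F.supp, t < s := by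
  obtain ⟨s, h1, h2⟩ := (((eventually_mem_supp ht).filter_mono
    (nhdsWithin_le_nhds (s := Ioi t))).and self_mem_nhdsWithin).exists
  exact ⟨s, h1, h2⟩

theorem integrableOn_density : IntegrableOn F.density F.supp := by
  by_contra h
  have := integral_undef h
  have h1 := F.integral_density
  simp only [supp] at this
  rw [this] at h1
  exact zero_ne_one h1

theorem ae_density_nonneg : 0 ≤ᵐ[volume.restrict F.supp] F.density := by
  filter_upwards [ae_restrict_mem F.measurableSet_supp] with v hv
  exact (F.density_pos v hv).le

instance isProbabilityMeasure_law : IsProbabilityMeasure F.law := by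
  refine ⟨?_⟩
  rw [law, withDensity_apply _ MeasurableSet.univ, Measure.restrict_univ,
    ← ofReal_integral_eq_lintegral_ofReal F.integrableOn_density F.ae_density_nonneg]
  have := F.integral_density
  simp only [supp]
  rw [this, ENNReal.ofReal_one]

theorem law_absolutelyContinuous_restrict : F.law ≪ volume.restrict F.supp :=
  withDensity_absolutelyContinuous _ _

theorem law_absolutelyContinuous : F.law ≪ volume :=
  F.law_absolutelyContinuous_restrict.trans Measure.absolutelyContinuous_restrict

theorem ae_mem_supp : ∀ᵐ v ∂F.law, v ∈ F.supp :=
  F.law_absolutelyContinuous_restrict.ae_le (ae_restrict_mem F.measurableSet_supp)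

instance nullSingletonClass_law : NullSingletonClass F.law :=
  ⟨fun x => F.law_absolutelyContinuous (by simp)⟩

theorem aemeasurable_ofReal_density :
    AEMeasurable (fun v => ENNReal.ofReal (F.density v)) (volume.restrict F.supp) :=
  F.integrableOn_density.aestronglyMeasurable.aemeasurable.ennreal_ofReal

theorem setIntegral_law (g : ℝ → ℝ) {s : Set ℝ} (hs : MeasurableSet s) :
    ∫ v in s, g v ∂F.law = ∫ v in F.supp ∩ s, F.density v * g v := by
  rw [law, restrict_withDensity hs, Measure.restrict_restrict hs,
    integral_withDensity_eq_integral_toReal_smul₀ (F.aemeasurable_ofReal_density.mono_measure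
      (Measure.restrict_mono inter_subset_right le_rfl)) (by simp), inter_comm]
  refine setIntegral_congr_fun (F.measurableSet_supp.inter hs) fun v hv => ?_
  simp only [smul_eq_mul]
  rw [ENNReal.toReal_ofReal (F.density_pos v hv.1).le]

theorem integrable_law_iff {g : ℝ → ℝ} :
    Integrable g F.law ↔ IntegrableOn (fun v => F.density v * g v) F.supp := by
  rw [law, integrable_withDensity_iff_integrable_smul₀' F.aemeasurable_ofReal_density (by simp)]
  refine integrable_congr ?_
  filter_upwards [ae_restrict_mem F.measurableSet_supp] with v hv
  simp only [smul_eq_mul]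
  rw [ENNReal.toReal_ofReal (F.density_pos v hv).le]

theorem integrableOn_mul_density : IntegrableOn (fun v => v * F.density v) F.supp :=
  F.finite_mean

theorem integrable_id_law : Integrable (fun v : ℝ => v) F.law := by
  rw [integrable_law_iff]
  simpa only [mul_comm] using F.integrableOn_mul_density

theorem cdf_eq : F.cdf = ProbabilityTheory.cdf F.law := by
  ext v
  rw [ProbabilityTheory.cdf_eq_real]
  rfl

theorem monotone_cdf : Monotone F.cdf := by
  rw [cdf_eq]; exact ProbabilityTheory.monotone_cdf _

theorem cdf_nonneg (v : ℝ) : 0 ≤ F.cdf v := measureReal_nonneg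

theorem cdf_le_one (v : ℝ) : F.cdf v ≤ 1 := measureReal_le_one

theorem cdf_mem_Icc (v : ℝ) : F.cdf v ∈ Icc (0 : ℝ) 1 := ⟨F.cdf_nonneg v, F.cdf_le_one v⟩

theorem continuous_cdf : Continuous F.cdf := by
  rw [continuous_iff_continuousAt]
  intro x
  rw [F.monotone_cdf.continuousAt_iff_leftLim_eq_rightLim, cdf_eq,
    StieltjesFunction.rightLim_eq]
  have h := (ProbabilityTheory.cdf F.law).measure_singleton x
  rw [ProbabilityTheory.measure_cdf, measure_singleton] at h
  have h1 := ENNReal.ofReal_eq_zero.1 h.symm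
  exact le_antisymm ((ProbabilityTheory.cdf F.law).mono.leftLim_le le_rfl) (by linarith)

theorem measurable_cdf : Measurable F.cdf := F.continuous_cdf.measurable

theorem law_Ioi (t : ℝ) : F.law.real (Ioi t) = 1 - F.cdf t := by
  rw [← compl_Iic, probReal_compl_eq_one_sub measurableSet_Iic]; rfl

theorem cdf_of_le_lo {t : ℝ} (ht : t ≤ F.lo) : F.cdf t = 0 := by
  rw [cdf, measureReal_eq_zero_iff]
  refine measure_mono_null (fun v hv => ?_) (ae_iff.1 F.ae_mem_supp)
  intro h
  exact absurd (h.1.trans_le hv) (not_lt.2 ht)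

theorem cdf_of_hi_le {t : ℝ} (ht : F.hi ≤ t) : F.cdf t = 1 := by
  have : F.law.real (Ioi t) = 0 := by
    rw [measureReal_eq_zero_iff]
    refine measure_mono_null (fun v hv => ?_) (ae_iff.1 F.ae_mem_supp)
    intro h
    exact absurd (h.2.trans_le (ht.trans (EReal.coe_le_coe_iff.2 (le_of_lt hv)))) (lt_irrefl _)
  linarith [F.law_Ioi t]

theorem mem_supp_of_cdf {t : ℝ} (ht : F.cdf t ∈ Ioo (0 : ℝ) 1) : t ∈ F.supp := by
  refine ⟨not_le.1 fun h => ?_, not_le.1 fun h => ?_⟩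
  · exact ht.1.ne' (F.cdf_of_le_lo h)
  · exact ht.2.ne (F.cdf_of_hi_le h)

theorem cdf_sub_cdf {x y : ℝ} (hx : x ∈ F.supp) (hy : y ∈ F.supp) :
    F.cdf y - F.cdf x = ∫ t in x..y, F.density t := by
  have key : ∀ {x y : ℝ}, x ∈ F.supp → y ∈ F.supp → x ≤ y →
      F.cdf y - F.cdf x = ∫ t in x..y, F.density t := by
    intro x y hx hy hxy
    have h1 : F.law.real (Ioc x y) = F.cdf y - F.cdf x := by
      rw [← Iic_sdiff_Iic, measureReal_sdiff (Iic_subset_Iic.2 hxy) measurableSet_Iic]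
      rfl
    have h2 := F.setIntegral_law (fun _ => (1 : ℝ)) (measurableSet_Ioc (a := x) (b := y))
    rw [inter_eq_self_of_subset_right
      (Ioc_subset_Icc_self.trans (F.ordConnected_supp.out hx hy))] at h2
    simp only [setIntegral_const, smul_eq_mul, mul_one] at h2
    rw [← h1, h2, intervalIntegral.integral_of_le hxy]
  rcases le_total x y with h | h
  · exact key hx hy h
  · rw [intervalIntegral.integral_symm, ← key hy hx h]; ring

theorem hasStrictDerivAt_cdf {v : ℝ} (hv : v ∈ F.supp) :
    HasStrictDerivAt F.cdf (F.density v) v := by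
  have key : ∀ w ∈ F.supp, HasDerivAt F.cdf (F.density w) w := by
    intro w hw
    have hc : ContinuousAt F.density w :=
      F.density_continuousOn.continuousAt (F.isOpen_supp.mem_nhds hw)
    have hm : StronglyMeasurableAtFilter F.density (𝓝 w) :=
      ContinuousOn.stronglyMeasurableAtFilter F.isOpen_supp F.density_continuousOn w hw
    have h := (intervalIntegral.integral_hasDerivAt_right (a := w) (b := w) (f := F.density)
      (by simp) hm hc).add_const (F.cdf w)
    refine h.congr_of_eventuallyEq ?_
    filter_upwards [F.isOpen_supp.mem_nhds hw] with y hy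
    rw [← F.cdf_sub_cdf hw hy]; ring
  refine hasStrictDerivAt_of_hasDerivAt_of_continuousAt
    ((eventually_mem_supp hv).mono key)
    (F.density_continuousOn.continuousAt (F.isOpen_supp.mem_nhds hv))

theorem strictMonoOn_cdf : StrictMonoOn F.cdf F.supp := by
  refine strictMonoOn_of_deriv_pos F.ordConnected_supp.convex F.continuous_cdf.continuousOn ?_
  rw [F.isOpen_supp.interior_eq]
  intro v hv
  rw [(F.hasStrictDerivAt_cdf hv).hasDerivAt.deriv]
  exact F.density_pos v hv

variable {F} in
theorem cdf_mem_Ioo {t : ℝ} (ht : t ∈ F.supp) : F.cdf t ∈ Ioo (0 : ℝ) 1 := by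
  obtain ⟨s, hs, hst⟩ := exists_lt_mem_supp ht
  obtain ⟨u, hu, htu⟩ := exists_gt_mem_supp ht
  exact ⟨(F.cdf_nonneg s).trans_lt (F.strictMonoOn_cdf hs ht hst),
    (F.strictMonoOn_cdf ht hu htu).trans_le (F.cdf_le_one u)⟩

theorem exists_cdf_eq {q : ℝ} (hq : q ∈ Ioo (0 : ℝ) 1) : ∃ t ∈ F.supp, F.cdf t = q := by
  have h0 : Tendsto F.cdf atBot (𝓝 0) := by
    rw [cdf_eq]; exact ProbabilityTheory.tendsto_cdf_atBot _
  have h1 : Tendsto F.cdf atTop (𝓝 1) := by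
    rw [cdf_eq]; exact ProbabilityTheory.tendsto_cdf_atTop _
  obtain ⟨a, ha⟩ := (h0.eventually_le_const hq.1).exists
  obtain ⟨b, hb⟩ := (h1.eventually_const_le hq.2).exists
  obtain ⟨t, ht⟩ := mem_range_of_exists_le_of_exists_ge F.continuous_cdf ⟨a, ha⟩ ⟨b, hb⟩
  exact ⟨t, F.mem_supp_of_cdf (ht ▸ hq), ht⟩

theorem supp_nonempty : F.supp.Nonempty :=
  let ⟨t, ht, _⟩ := F.exists_cdf_eq (q := 1 / 2) (by norm_num)
  ⟨t, ht⟩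

theorem law_real_cdf_le {q : ℝ} (h0 : 0 ≤ q) (h1 : q ≤ 1) : F.law.real {v | F.cdf v ≤ q} = q := by
  rcases h1.eq_or_lt with rfl | h1
  · have : {v | F.cdf v ≤ 1} = univ := eq_univ_of_forall F.cdf_le_one
    rw [this, probReal_univ]
  refine le_antisymm (le_of_forall_gt_imp_ge_of_dense fun a ha => ?_) ?_
  · obtain ⟨b, hqb, hb⟩ := exists_between (lt_min ha h1)
    obtain ⟨t, -, ht⟩ := F.exists_cdf_eq (q := b) ⟨by linarith, hb.trans_le (min_le_right _ _)⟩
    calc F.law.real {v | F.cdf v ≤ q} ≤ F.law.real (Iic t) := by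
          refine measureReal_mono fun v hv => ?_
          by_contra h
          have := F.monotone_cdf (le_of_lt (not_le.1 h))
          rw [ht] at this
          exact absurd (hqb.trans_le this) (not_lt.2 hv)
      _ = b := ht
      _ ≤ a := (hb.trans_le (min_le_left _ _)).le
  · rcases h0.eq_or_lt with rfl | h0
    · exact measureReal_nonneg
    obtain ⟨t, -, ht⟩ := F.exists_cdf_eq ⟨h0, h1⟩
    calc q = F.law.real (Iic t) := ht.symm
      _ ≤ _ := measureReal_mono fun v hv => (F.monotone_cdf hv).trans ht.le

/-- The quantile of a random valuation is uniform, since `cdf` is continuous. This transfers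
integrals of `ironed` to integrals of `slopeHull` over the unit interval. -/
theorem map_cdf_law : F.law.map F.cdf = volume.restrict (Icc 0 1) := by
  have : IsProbabilityMeasure (F.law.map F.cdf) :=
    Measure.isProbabilityMeasure_map F.measurable_cdf.aemeasurable
  refine Measure.ext_of_Iic _ _ fun a => ?_
  rw [Measure.map_apply F.measurable_cdf measurableSet_Iic,
    Measure.restrict_apply measurableSet_Iic]
  change F.law {v | F.cdf v ≤ a} = _
  rw [← ofReal_measureReal]
  rcases lt_or_ge a 0 with ha | ha
  · have h1 : {v | F.cdf v ≤ a} = ∅ :=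
      eq_empty_of_forall_notMem fun v hv => absurd (F.cdf_nonneg v) (not_le.2 (hv.trans_lt ha))
    have h2 : Iic a ∩ Icc (0 : ℝ) 1 = ∅ :=
      eq_empty_of_forall_notMem fun v hv => by linarith [hv.1.out, hv.2.1]
    rw [h1, h2]; simp
  · rcases le_total a 1 with h1 | h1
    · have h2 : Iic a ∩ Icc (0 : ℝ) 1 = Icc 0 a := by
        ext x; simp only [mem_inter_iff, mem_Iic, mem_Icc]
        constructor
        · rintro ⟨h, h', -⟩; exact ⟨h', h⟩
        · rintro ⟨h, h'⟩; exact ⟨h', h, h'.trans h1⟩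
      rw [F.law_real_cdf_le ha h1, h2, Real.volume_Icc, sub_zero]
    · have h2 : Iic a ∩ Icc (0 : ℝ) 1 = Icc 0 1 :=
        inter_eq_self_of_subset_right fun x hx => hx.2.trans h1
      have h3 : {v | F.cdf v ≤ a} = univ := eq_univ_of_forall fun v => (F.cdf_le_one v).trans h1
      rw [h2, h3]; simp

theorem ae_cdf_ne (q : ℝ) : ∀ᵐ v ∂F.law, F.cdf v ≠ q := by
  have h : ∀ᵐ x ∂(F.law.map F.cdf), x ≠ q := by
    rw [map_cdf_law]
    exact ae_restrict_of_ae (by simp [ae_iff])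
  exact ae_of_ae_map F.measurable_cdf.aemeasurable h

/-! ### The cumulative virtual value -/

theorem integrableOn_one_sub_cdf : IntegrableOn (fun t => 1 - F.cdf t) (Ioi 0) := by
  refine ⟨(measurable_const.sub F.measurable_cdf).aestronglyMeasurable, ?_⟩
  have h0 : 0 ≤ᵐ[F.law] fun v => v := by
    filter_upwards [F.ae_mem_supp] with v hv using (pos_of_mem_supp hv).le
  have h := lintegral_eq_lintegral_meas_lt F.law h0 F.integrable_id_law.aemeasurable
  have hfin := F.integrable_id_law.hasFiniteIntegral
  rw [hasFiniteIntegral_iff_ofReal h0, h] at hfin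
  rw [hasFiniteIntegral_iff_ofReal (ae_of_all _ fun t => sub_nonneg.2 (F.cdf_le_one t))]
  refine lt_of_eq_of_lt (lintegral_congr fun t => ?_) hfin
  rw [← F.law_Ioi t, ofReal_measureReal]
  rfl

theorem supp_subset_Ioi : F.supp ⊆ Ioi 0 := fun _ hv => pos_of_mem_supp hv

theorem density_mul_virtualValue {v : ℝ} (hv : v ∈ F.supp) :
    F.density v * F.virtualValue v = v * F.density v - (1 - F.cdf v) := by
  have := (F.density_pos v hv).ne'
  rw [virtualValue]
  field_simp

theorem integrableOn_sub_one_sub_cdf :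
    IntegrableOn (fun v => v * F.density v - (1 - F.cdf v)) F.supp :=
  F.integrableOn_mul_density.sub (F.integrableOn_one_sub_cdf.mono_set F.supp_subset_Ioi)

theorem integrable_virtualValue : Integrable F.virtualValue F.law := by
  rw [integrable_law_iff]
  exact F.integrableOn_sub_one_sub_cdf.congr_fun
    (fun v hv => (F.density_mul_virtualValue hv).symm) F.measurableSet_supp

theorem setIntegral_virtualValue {s : Set ℝ} (hs : MeasurableSet s) :
    ∫ v in s, F.virtualValue v ∂F.law
      = ∫ v in F.supp ∩ s, (v * F.density v - (1 - F.cdf v)) := by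
  rw [F.setIntegral_law _ hs]
  exact setIntegral_congr_fun (F.measurableSet_supp.inter hs)
    fun v hv => F.density_mul_virtualValue hv.1

/-- Layer-cake formula: the tail probability is one up to `lo` and zero past `hi`. -/
theorem integral_id_law : ∫ v, v ∂F.law = F.lo + ∫ v in F.supp, (1 - F.cdf v) := by
  have h0 : 0 ≤ᵐ[F.law] fun v => v := by
    filter_upwards [F.ae_mem_supp] with v hv using (pos_of_mem_supp hv).le
  rw [F.integrable_id_law.integral_eq_integral_meas_lt h0]
  have h1 : ∀ t, F.law.real {a | t < a} = 1 - F.cdf t := F.law_Ioi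
  simp_rw [h1]
  rw [← Ioc_union_Ioi_eq_Ioi F.lo_nonneg, setIntegral_union (Ioc_disjoint_Ioi le_rfl)
    measurableSet_Ioi (F.integrableOn_one_sub_cdf.mono_set fun x hx => hx.1)
    (F.integrableOn_one_sub_cdf.mono_set (Ioi_subset_Ioi F.lo_nonneg))]
  congr 1
  · rw [setIntegral_congr_fun (g := fun _ => (1 : ℝ)) measurableSet_Ioc
      fun t ht => by simp [F.cdf_of_le_lo ht.2]]
    simp [F.lo_nonneg]
  · refine (setIntegral_eq_of_subset_of_forall_sdiff_eq_zero measurableSet_Ioi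
      (fun v hv => hv.1) fun t ht => ?_)
    rw [F.cdf_of_hi_le (not_lt.1 fun h => ht.2 ⟨ht.1, h⟩), sub_self]

theorem cumVirtual_one : F.cumVirtual 1 = F.lo := by
  have h : {v | F.cdf v ≤ 1} = univ := eq_univ_of_forall F.cdf_le_one
  rw [cumVirtual, h, F.setIntegral_virtualValue MeasurableSet.univ, inter_univ, integral_sub
    F.integrableOn_mul_density (F.integrableOn_one_sub_cdf.mono_set F.supp_subset_Ioi)]
  have h1 := F.setIntegral_law (fun v => v) MeasurableSet.univ
  rw [inter_univ, Measure.restrict_univ, F.integral_id_law] at h1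
  simp_rw [mul_comm] at h1 ⊢
  linarith

/-- The integrand `v * density v - (1 - cdf v)` is the derivative of `-(v * (1 - cdf v))`. Thus `lo
- cumVirtual` at the quantile of `t` is the revenue from one bidder at the posted price `t`. -/
theorem cumVirtual_cdf {t : ℝ} (ht : t ∈ F.supp) :
    F.cumVirtual (F.cdf t) = F.lo - t * (1 - F.cdf t) := by
  have hset : (F.supp ∩ {v | F.cdf v ≤ F.cdf t}) = Ioc F.lo t := by
    ext v
    constructor
    · rintro ⟨hv, hvt⟩
      exact ⟨hv.1, (F.strictMonoOn_cdf.le_iff_le hv ht).1 hvt⟩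
    · intro hv
      exact ⟨Ioc_lo_subset_supp ht hv, F.monotone_cdf hv.2⟩
  rw [cumVirtual, F.setIntegral_virtualValue (measurableSet_le F.measurable_cdf measurable_const),
    hset, ← intervalIntegral.integral_of_le ht.1.le]
  have h := intervalIntegral.integral_eq_sub_of_hasDerivAt_of_le (a := F.lo) (b := t)
    (f := fun v => -(v * (1 - F.cdf v))) (f' := fun v => v * F.density v - (1 - F.cdf v)) ht.1.le
    (by have := F.continuous_cdf; fun_prop) (fun v hv => by
      have hd := (F.hasStrictDerivAt_cdf
        (Ioc_lo_subset_supp ht (Ioo_subset_Ioc_self hv))).hasDerivAt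
      refine ((hasDerivAt_id v).mul (hd.const_sub 1)).neg.congr_deriv ?_
      simp only [id]; ring)
    ((intervalIntegrable_iff_integrableOn_Ioc_of_le ht.1.le).2
      (F.integrableOn_sub_one_sub_cdf.mono_set (Ioc_lo_subset_supp ht)))
  rw [h, F.cdf_of_le_lo le_rfl]
  ring

theorem cumVirtual_zero : F.cumVirtual 0 = 0 := by
  have : F.law {v | F.cdf v ≤ 0} = 0 := by
    have := F.law_real_cdf_le le_rfl zero_le_one
    rwa [measureReal_eq_zero_iff] at this
  rw [cumVirtual, Measure.restrict_eq_zero.2 this, integral_zero_measure]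

/-- Dominated convergence: as a function of `q`, the truncated integrand jumps at a given `q` only
for `v` in the null set `cdf v = q`. -/
theorem continuous_cumVirtual : Continuous F.cumVirtual := by
  rw [continuous_iff_continuousAt]
  intro q
  have heq : F.cumVirtual = fun q => ∫ v, {v | F.cdf v ≤ q}.indicator F.virtualValue v ∂F.law := by
    ext q
    rw [integral_indicator (measurableSet_le F.measurable_cdf measurable_const)]
    rfl
  rw [heq]
  refine continuousAt_of_dominated (bound := fun v => |F.virtualValue v|)
    (Eventually.of_forall fun x => F.integrable_virtualValue.aestronglyMeasurable.indicator
      (measurableSet_le F.measurable_cdf measurable_const))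
    (Eventually.of_forall fun x => ae_of_all _ fun v => norm_indicator_le_norm_self _ _)
    F.integrable_virtualValue.abs ?_
  filter_upwards [F.ae_cdf_ne q] with v hv
  rcases hv.lt_or_gt with h | h
  · refine (continuousAt_const (y := F.virtualValue v)).congr ?_
    filter_upwards [lt_mem_nhds h] with x hx
    rw [indicator_of_mem (show v ∈ {v | F.cdf v ≤ x} from le_of_lt hx)]
  · refine (continuousAt_const (y := (0 : ℝ))).congr ?_
    filter_upwards [gt_mem_nhds h] with x hx
    rw [indicator_of_notMem (show v ∉ {v | F.cdf v ≤ x} from not_le.2 hx)]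

/-- The density is continuous and positive, so `cdf` has a differentiable local inverse `g`, and
near the quantile `cumVirtual y` equals `lo - g y * (1 - y)`. -/
theorem exists_hasDerivAt_cumVirtual {q : ℝ} (hq : q ∈ Ioo (0 : ℝ) 1) :
    ∃ d, HasDerivAt F.cumVirtual d q := by
  obtain ⟨t, ht, rfl⟩ := F.exists_cdf_eq hq
  have hs := F.hasStrictDerivAt_cdf ht
  have hne := (F.density_pos t ht).ne'
  set g := hs.localInverse F.cdf _ t hne
  have hg : HasStrictDerivAt g (F.density t)⁻¹ (F.cdf t) := hs.to_localInverse hne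
  have hgt : g (F.cdf t) = t :=
    HasStrictFDerivAt.localInverse_apply_image (hs.hasStrictFDerivAt_equiv hne)
  have hright : ∀ᶠ y in 𝓝 (F.cdf t), F.cdf (g y) = y :=
    HasStrictFDerivAt.eventually_right_inverse (hs.hasStrictFDerivAt_equiv hne)
  have hmem : ∀ᶠ y in 𝓝 (F.cdf t), g y ∈ F.supp :=
    hg.hasDerivAt.continuousAt.eventually_mem (by
      rw [hgt]; exact F.isOpen_supp.mem_nhds ht)
  have hd : HasDerivAt (fun y => F.lo - g y * (1 - y)) _ (F.cdf t) :=
    (hg.hasDerivAt.mul ((hasDerivAt_id _).const_sub 1)).const_sub F.lo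
  refine ⟨_, hd.congr_of_eventuallyEq ?_⟩
  filter_upwards [hright, hmem] with y h1 h2
  conv_lhs => rw [← h1]
  rw [F.cumVirtual_cdf h2, h1]

/-! ### Ironed virtual values -/

theorem convexHull_eq : F.convexHull = convexMinorant F.cumVirtual := rfl

theorem convexOn_convexHull : ConvexOn ℝ (Icc 0 1) F.convexHull :=
  convexOn_convexMinorant F.continuous_cumVirtual.continuousOn

theorem continuousOn_convexHull : ContinuousOn F.convexHull (Icc 0 1) :=
  continuousOn_convexMinorant F.continuous_cumVirtual.continuousOn

theorem convexHull_le {q : ℝ} (hq : q ∈ Icc (0 : ℝ) 1) : F.convexHull q ≤ F.cumVirtual q :=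
  convexMinorant_le F.continuous_cumVirtual.continuousOn hq

theorem convexHull_zero : F.convexHull 0 = 0 :=
  (convexMinorant_endpoint F.continuous_cumVirtual.continuousOn (Or.inl rfl)).trans
    F.cumVirtual_zero

theorem convexHull_one : F.convexHull 1 = F.lo :=
  (convexMinorant_endpoint F.continuous_cumVirtual.continuousOn (Or.inr rfl)).trans
    F.cumVirtual_one

/-- The slope of the convex hull at a quantile. -/
def slopeHull (q : ℝ) : ℝ := derivWithin F.convexHull (Ioi q) q

theorem ironed_eq (v : ℝ) : F.ironed v = F.slopeHull (F.cdf v) := rfl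

theorem hasDerivAt_convexHull {q : ℝ} (hq : q ∈ Ioo (0 : ℝ) 1) :
    HasDerivAt F.convexHull (F.slopeHull q) q := by
  obtain ⟨d, hd⟩ := F.exists_hasDerivAt_cumVirtual hq
  obtain ⟨d', hd'⟩ := exists_hasDerivAt_convexMinorant F.continuous_cumVirtual.continuousOn hq hd
  rw [slopeHull, convexHull_eq, hd'.hasDerivWithinAt.derivWithin (uniqueDiffWithinAt_Ioi _)]
  exact hd'

theorem monotoneOn_slopeHull : MonotoneOn F.slopeHull (Ioo 0 1) := by
  have := F.convexOn_convexHull.monotoneOn_rightDeriv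
  rwa [interior_Icc] at this

theorem monotoneOn_ironed : MonotoneOn F.ironed F.supp := fun _ hx _ hy hxy =>
  F.monotoneOn_slopeHull (cdf_mem_Ioo hx) (cdf_mem_Ioo hy) (F.monotone_cdf hxy)

/-- In the quantile variable the ironed virtual value is a derivative, so Darboux's theorem applies.
-/
theorem exists_ironed_eq {u w y : ℝ} (hu : u ∈ F.supp) (hw : w ∈ F.supp) (huy : F.ironed u < y)
    (hyw : y < F.ironed w) : ∃ x ∈ F.supp, F.ironed x = y := by
  have huw : u ≤ w := by
    by_contra h
    exact absurd ((F.monotoneOn_ironed hw hu (not_le.1 h).le).trans_lt huy) (not_lt.2 hyw.le)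
  have hsub : Icc (F.cdf u) (F.cdf w) ⊆ Ioo 0 1 := fun x hx =>
    ⟨(cdf_mem_Ioo hu).1.trans_le hx.1, hx.2.trans_lt (cdf_mem_Ioo hw).2⟩
  obtain ⟨q, hq, hqy⟩ := exists_hasDerivWithinAt_eq_of_gt_of_lt (F.monotone_cdf huw)
    (fun x hx => (F.hasDerivAt_convexHull (hsub hx)).hasDerivWithinAt) huy hyw
  obtain ⟨x, hx, hxq⟩ := F.exists_cdf_eq (hsub (Ioo_subset_Icc_self hq))
  exact ⟨x, hx, by rw [ironed_eq, hxq, hqy]⟩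

/-- A derivative of constant sign of a continuous function is integrable. The slope is monotone, so
subtracting its value at `1 / 2` fixes the sign on each half. -/
theorem integrableOn_slopeHull : IntegrableOn F.slopeHull (Ioo 0 1) := by
  have hmid : (1 / 2 : ℝ) ∈ Ioo (0 : ℝ) 1 := by norm_num
  set m := F.slopeHull (1 / 2) with hm
  have hlin : ∀ (q : ℝ), HasDerivAt (fun q => m * q) m q := fun q => by
    simpa using (hasDerivAt_id q).const_mul m
  have hcont : ContinuousOn (fun q => F.convexHull q - m * q) (Icc 0 1) :=
    F.continuousOn_convexHull.sub (by fun_prop)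
  have h1 : IntegrableOn (fun q => F.slopeHull q - m) (Ioc (1 / 2) 1) :=
    intervalIntegral.integrableOn_deriv_of_nonneg (g := fun q => F.convexHull q - m * q)
      (hcont.mono (Icc_subset_Icc_left (by norm_num)))
      (fun x hx => (F.hasDerivAt_convexHull ⟨by linarith [hx.1], hx.2⟩).sub (hlin x))
      (fun x hx => sub_nonneg.2 (F.monotoneOn_slopeHull hmid ⟨by linarith [hx.1], hx.2⟩ hx.1.le))
  have h2 : IntegrableOn (fun q => m - F.slopeHull q) (Ioc 0 (1 / 2)) :=
    intervalIntegral.integrableOn_deriv_of_nonneg (g := fun q => m * q - F.convexHull q)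
      (((continuous_const.mul continuous_id).continuousOn.sub F.continuousOn_convexHull).mono
        (Icc_subset_Icc_right (by norm_num)))
      (fun x hx => (hlin x).sub (F.hasDerivAt_convexHull ⟨hx.1, by linarith [hx.2]⟩))
      (fun x hx => sub_nonneg.2 (F.monotoneOn_slopeHull ⟨hx.1, by linarith [hx.2]⟩ hmid hx.2.le))
  have hc : ∀ a b : ℝ, IntegrableOn (fun _ : ℝ => m) (Ioc a b) := fun a b =>
    integrableOn_const (by simp)
  have h1' : IntegrableOn F.slopeHull (Ioc (1 / 2) 1) :=
    (h1.add (hc _ _)).congr (ae_of_all _ fun x => by simp)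
  have h2' : IntegrableOn F.slopeHull (Ioc 0 (1 / 2)) :=
    ((hc _ _).sub h2).congr (ae_of_all _ fun x => by simp)
  have := h2'.union h1'
  rw [Ioc_union_Ioc_eq_Ioc (by norm_num) (by norm_num)] at this
  exact this.mono_set Ioo_subset_Ioc_self

theorem map_cdf_law_Ioo : F.law.map F.cdf = volume.restrict (Ioo 0 1) := by
  rw [map_cdf_law, restrict_Ioo_eq_restrict_Icc]

theorem measurable_slopeHull : Measurable F.slopeHull := measurable_derivWithin_Ioi F.convexHull

theorem integrable_ironed : Integrable F.ironed F.law := by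
  have h : Integrable F.slopeHull (F.law.map F.cdf) := by
    rw [map_cdf_law_Ioo]; exact F.integrableOn_slopeHull
  exact h.comp_measurable F.measurable_cdf

theorem setIntegral_ironed_cdf {q : ℝ} (h0 : 0 ≤ q) (h1 : q ≤ 1) :
    ∫ v in {v | q < F.cdf v}, F.ironed v ∂F.law = F.lo - F.convexHull q := by
  have h : ∫ x in Ioi q, F.slopeHull x ∂(F.law.map F.cdf)
      = ∫ v in F.cdf ⁻¹' (Ioi q), F.slopeHull (F.cdf v) ∂F.law :=
    setIntegral_map measurableSet_Ioi F.measurable_slopeHull.aestronglyMeasurable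
      F.measurable_cdf.aemeasurable
  have hset : Ioi q ∩ Ioo (0 : ℝ) 1 = Ioo q 1 := by
    ext x
    simp only [mem_inter_iff, mem_Ioi, mem_Ioo]
    exact ⟨fun h => ⟨h.1, h.2.2⟩, fun h => ⟨h.1, h0.trans_lt h.1, h.2⟩⟩
  rw [map_cdf_law_Ioo, Measure.restrict_restrict measurableSet_Ioi, hset,
    ← integral_Ioc_eq_integral_Ioo, ← intervalIntegral.integral_of_le h1] at h
  rw [intervalIntegral.integral_eq_sub_of_hasDerivAt_of_le h1
    (F.continuousOn_convexHull.mono (Icc_subset_Icc_left h0))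
    (fun x hx => F.hasDerivAt_convexHull ⟨h0.trans_lt hx.1, hx.2⟩)
    ((intervalIntegrable_iff_integrableOn_Ioo_of_le h1).2
      (F.integrableOn_slopeHull.mono_set (Ioo_subset_Ioo_left h0))), convexHull_one] at h
  exact h.symm

theorem setIntegral_ironed {t : ℝ} (ht : t ∈ F.supp) :
    ∫ v in Ioi t, F.ironed v ∂F.law = F.lo - F.convexHull (F.cdf t) := by
  rw [← F.setIntegral_ironed_cdf (F.cdf_nonneg t) (F.cdf_le_one t)]
  refine setIntegral_congr_set ?_
  filter_upwards [F.ae_mem_supp] with v hv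
  exact propext (F.strictMonoOn_cdf.lt_iff_lt ht hv).symm

theorem integral_ironed : ∫ v, F.ironed v ∂F.law = F.lo := by
  have h := F.setIntegral_ironed_cdf le_rfl zero_le_one
  rw [convexHull_zero, sub_zero] at h
  rw [← h, ← setIntegral_univ]
  refine setIntegral_congr_set ?_
  filter_upwards [F.ae_mem_supp] with v hv
  exact propext ⟨fun _ => (cdf_mem_Ioo hv).1, fun _ => trivial⟩

/-- Where ironing takes effect the hull is affine, so its slope is constant on both sides of `t`. -/
theorem ironed_const_near {t : ℝ} (ht : t ∈ F.supp)
    (hlt : F.convexHull (F.cdf t) < F.cumVirtual (F.cdf t)) :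
    ∃ a ∈ F.supp, ∃ b ∈ F.supp, a < t ∧ t < b ∧ F.ironed a = F.ironed b := by
  obtain ⟨m, hm⟩ := convexMinorant_affine_near F.continuous_cumVirtual.continuousOn
    (cdf_mem_Ioo ht) hlt
  have hev : ∀ᶠ q in 𝓝 (F.cdf t), F.slopeHull q = m := by
    filter_upwards [hm.eventually_nhds, Ioo_mem_nhds (cdf_mem_Ioo ht).1 (cdf_mem_Ioo ht).2]
      with q hq hqI
    have h1 := F.hasDerivAt_convexHull hqI
    have h2 : HasDerivAt (fun x => convexMinorant F.cumVirtual (F.cdf t) + m * (x - F.cdf t)) m q := by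
      simpa using (((hasDerivAt_id q).sub_const (F.cdf t)).const_mul m).const_add
        (convexMinorant F.cumVirtual (F.cdf t))
    exact h1.unique (h2.congr_of_eventuallyEq hq)
  have hev' : ∀ᶠ x in 𝓝 t, x ∈ F.supp ∧ F.ironed x = m :=
    (eventually_mem_supp ht).and
      (F.continuous_cdf.continuousAt.eventually hev)
  obtain ⟨a, ⟨ha, ham⟩, hat⟩ := ((hev'.filter_mono (nhdsWithin_le_nhds (s := Iio t))).and
    self_mem_nhdsWithin).exists
  obtain ⟨b, ⟨hb, hbm⟩, hbt⟩ := ((hev'.filter_mono (nhdsWithin_le_nhds (s := Ioi t))).and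
    self_mem_nhdsWithin).exists
  exact ⟨a, ha, b, hb, hat, hbt, ham.trans hbm.symm⟩

/-! ### The inverse of the ironed virtual value and the level of a bid -/

theorem ironedInv_le {v y : ℝ} (hv : v ∈ F.supp) (hy : y ≤ F.ironed v) :
    F.ironedInv y ≤ v := by
  rw [ironedInv]
  split_ifs with h1 h2
  · obtain ⟨x, hx, hxy⟩ := h1
    rcases le_total x v with hxv | hvx
    · exact sInf_le_of_le ⟨x, ⟨hx, hxy⟩, rfl⟩ (EReal.coe_le_coe_iff.2 hxv)
    · exact sInf_le ⟨v, ⟨hv, le_antisymm ((F.monotoneOn_ironed hv hx hvx).trans hxy.le) hy⟩, rfl⟩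
  · exact EReal.coe_le_coe_iff.2 hv.1.le
  -- The default `hi` would require an ironed value below `y`; together with the one at `v` the
  -- intermediate value property produces a preimage of `y`.
  · exfalso
    push Not at h1 h2
    obtain ⟨u, hu, huy⟩ := h2
    obtain ⟨x, hx, hxy⟩ := F.exists_ironed_eq hu hv (huy.lt_of_ne (h1 u hu))
      (hy.lt_of_ne (h1 v hv).symm)
    exact h1 x hx hxy

theorem lo_le_ironedInv (y : ℝ) : (F.lo : EReal) ≤ F.ironedInv y := by
  rw [ironedInv]
  split_ifs
  · refine le_sInf ?_
    rintro _ ⟨x, hx, rfl⟩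
    exact EReal.coe_le_coe_iff.2 hx.1.1.le
  · exact le_rfl
  · obtain ⟨x, hx⟩ := F.supp_nonempty
    exact (EReal.coe_le_coe_iff.2 hx.1.le).trans hx.2.le

theorem le_ironed_of_ironedInv_lt {t y : ℝ} (ht : t ∈ F.supp) (h : F.ironedInv y < t) :
    y ≤ F.ironed t := by
  rw [ironedInv] at h
  split_ifs at h with h1 h2
  · obtain ⟨_, ⟨x, ⟨hx, hxy⟩, rfl⟩, hxt⟩ := sInf_lt_iff.1 h
    exact hxy.symm.le.trans (F.monotoneOn_ironed hx ht (EReal.coe_lt_coe_iff.1 hxt).le)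
  · exact (h2 t ht).le
  · exact absurd (h.trans ht.2) (lt_irrefl _)

theorem monotone_bidLevel : Monotone F.bidLevel := fun _ _ hst =>
  biSup_mono fun _ hx => ⟨hx.1, hx.2.trans hst⟩

theorem measurable_bidLevel : Measurable F.bidLevel := F.monotone_bidLevel.measurable

theorem bidLevel_of_mem {t : ℝ} (ht : t ∈ F.supp) : F.bidLevel t = F.ironed t :=
  le_antisymm (iSup₂_le fun _ hx => EReal.coe_le_coe_iff.2 (F.monotoneOn_ironed hx.1 ht hx.2))
    (le_iSup₂_of_le t ⟨ht, le_rfl⟩ le_rfl)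

theorem bidLevel_of_le_lo {t : ℝ} (ht : t ≤ F.lo) : F.bidLevel t = ⊥ :=
  eq_bot_iff.2 (iSup₂_le fun _ hx => absurd (hx.1.1.trans_le (hx.2.trans ht)) (lt_irrefl _))

end ValueDist

namespace ValueDist

variable (F : ValueDist)

/-! ### Expected payments and expected ironed virtual surplus of a single bidder -/

/-- The ironed virtual surplus minus the payment of a bidder of valuation `v` who faces the
allocation rule `x`. -/
def gap (x : ℝ → ℝ) (v : ℝ) : ℝ := F.ironed v * x v - (v * x v - ∫ t in (0 : ℝ)..v, x t)

variable {F} {x y : ℝ → ℝ} {U : Set ℝ}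

theorem integrable_gap (hx : Monotone x) (h0 : ∀ t, 0 ≤ x t) (h1 : ∀ t, x t ≤ 1) :
    Integrable (F.gap x) F.law := by
  have hb : ∀ t, ‖x t‖ ≤ 1 := fun t => by
    rw [Real.norm_eq_abs, abs_of_nonneg (h0 t)]; exact h1 t
  have hm : AEStronglyMeasurable x F.law := hx.measurable.aestronglyMeasurable
  have hint : ∀ a b, IntervalIntegrable x volume a b := fun a b => hx.intervalIntegrable
  refine (F.integrable_ironed.mul_bdd hm (ae_of_all _ hb)).sub
    ((F.integrable_id_law.mul_bdd hm (ae_of_all _ hb)).sub ?_)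
  refine F.integrable_id_law.mono
    (intervalIntegral.continuous_primitive hint 0).aestronglyMeasurable (ae_of_all _ fun v => ?_)
  have := intervalIntegral.norm_integral_le_of_norm_le_const (a := 0) (b := v) (f := x) (C := 1)
    fun t _ => hb t
  simpa using this

theorem abs_gap_sub_gap_le (hx : Monotone x) (hy : ∀ a b, IntervalIntegrable y volume a b) {ε : ℝ}
    (h : ∀ t, |x t - y t| ≤ ε) {v : ℝ} (hv : 0 ≤ v) :
    |F.gap x v - F.gap y v| ≤ (|F.ironed v| + 2 * v) * ε := by
  have h1 : F.gap x v - F.gap y v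
      = (F.ironed v - v) * (x v - y v) + ∫ t in (0 : ℝ)..v, (x t - y t) := by
    rw [intervalIntegral.integral_sub hx.intervalIntegrable (hy _ _), gap, gap]
    ring
  have h2 := intervalIntegral.norm_integral_le_of_norm_le_const (a := 0) (b := v)
    (f := fun t => x t - y t) (C := ε) fun t _ => h t
  rw [sub_zero, abs_of_nonneg hv, Real.norm_eq_abs] at h2
  rw [h1]
  calc |(F.ironed v - v) * (x v - y v) + ∫ t in (0 : ℝ)..v, (x t - y t)|
      ≤ |(F.ironed v - v)| * |x v - y v| + |∫ t in (0 : ℝ)..v, (x t - y t)| := by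
        rw [← abs_mul]; exact abs_add_le _ _
    _ ≤ (|F.ironed v| + v) * ε + ε * v := by
        refine add_le_add (mul_le_mul ?_ (h v) (abs_nonneg _) (by positivity)) h2
        exact (abs_sub _ _).trans (by rw [abs_of_nonneg hv])
    _ = _ := by ring

/-! ### Threshold allocation rules. -/

theorem monotone_indicator_one (hU : IsUpperSet U) : Monotone (U.indicator (1 : ℝ → ℝ)) := by
  intro a b hab
  by_cases ha : a ∈ U
  · rw [indicator_of_mem ha, indicator_of_mem (hU hab ha)]; rfl
  · rw [indicator_of_notMem ha]; exact indicator_nonneg (fun _ _ => zero_le_one) _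

theorem mem_of_sInf_lt (hU : IsUpperSet U) {t u : ℝ} (hu : u ∈ U) (hu0 : 0 ≤ u)
    (h : sInf (U ∩ Ici 0) < t) : t ∈ U := by
  obtain ⟨w, hw, hwt⟩ := exists_lt_of_csInf_lt (⟨u, hu, hu0⟩ : (U ∩ Ici 0).Nonempty) h
  exact hU hwt.le hw.1

theorem sInf_le_of_mem {t : ℝ} (ht : t ∈ U) (ht0 : 0 ≤ t) : sInf (U ∩ Ici 0) ≤ t :=
  csInf_le ⟨0, fun _ h => h.2⟩ ⟨ht, ht0⟩

theorem sInf_nonneg_of_upper : 0 ≤ sInf (U ∩ Ici (0 : ℝ)) := Real.sInf_nonneg fun _ h => h.2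

/-- A winner pays the threshold of `U`. Whether the threshold itself belongs to `U` changes the
integral only on a null set. -/
theorem payment_indicator (hU : IsUpperSet U) {v : ℝ} (hv : 0 ≤ v) :
    v * U.indicator (1 : ℝ → ℝ) v - ∫ t in (0 : ℝ)..v, U.indicator (1 : ℝ → ℝ) t
      = sInf (U ∩ Ici 0) * U.indicator (1 : ℝ → ℝ) v := by
  rw [intervalIntegral.integral_of_le hv]
  by_cases hvU : v ∈ U
  · have hτv := sInf_le_of_mem hvU hv
    have hset : (Ioc 0 v ∩ U : Set ℝ) =ᵐ[volume] Ioc (sInf (U ∩ Ici 0)) v := by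
      have hae : ∀ᵐ t : ℝ, t ≠ sInf (U ∩ Ici 0) := by simp [ae_iff]
      filter_upwards [hae] with t ht
      refine propext ⟨fun h => ?_, fun h => ?_⟩
      · exact ⟨(sInf_le_of_mem h.2 h.1.1.le).lt_of_ne ht.symm, h.1.2⟩
      · exact ⟨⟨sInf_nonneg_of_upper.trans_lt h.1, h.2⟩, mem_of_sInf_lt hU hvU hv h.1⟩
    rw [setIntegral_indicator hU.ordConnected.measurableSet, setIntegral_congr_set hset]
    simp only [Pi.one_apply, setIntegral_const, smul_eq_mul, mul_one, Real.volume_real_Ioc_of_le hτv,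
      indicator_of_mem hvU]
    ring
  · rw [setIntegral_congr_fun (g := fun _ => (0 : ℝ)) measurableSet_Ioc fun t ht =>
      indicator_of_notMem (fun h => hvU (hU ht.2 h)) _]
    simp [hvU]

theorem integral_gap_indicator (hU : IsUpperSet U) :
    ∫ v, F.gap (U.indicator 1) v ∂F.law
      = ∫ v in U, (F.ironed v - sInf (U ∩ Ici 0)) ∂F.law := by
  rw [← integral_indicator hU.ordConnected.measurableSet]
  refine integral_congr_ae ?_
  filter_upwards [F.ae_mem_supp] with v hv
  rw [gap, payment_indicator hU (pos_of_mem_supp hv).le, ← sub_mul]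
  by_cases hvU : v ∈ U <;> simp [hvU]

/-- The cases are a null `U`, a threshold at or below the left end of the support, and a threshold
`t` inside it. In the last one the ironed surplus above `t` is `lo - convexHull` and the expected
payment is `t * (1 - cdf t) = lo - cumVirtual`. -/
theorem integral_gap_indicator_cases (hU : IsUpperSet U) :
    ∫ v, F.gap (U.indicator 1) v ∂F.law = 0 ∨
    ((∃ u ∈ U, u ∈ F.supp) ∧ sInf (U ∩ Ici 0) ≤ F.lo ∧
      ∫ v, F.gap (U.indicator 1) v ∂F.law = F.lo - sInf (U ∩ Ici 0)) ∨
    ∃ t ∈ F.supp, (∀ s ∈ F.supp, t < s → s ∈ U) ∧ (∀ s ∈ F.supp, s < t → s ∉ U) ∧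
      ∫ v, F.gap (U.indicator 1) v ∂F.law
        = F.cumVirtual (F.cdf t) - F.convexHull (F.cdf t) := by
  rw [integral_gap_indicator hU]
  set τ := sInf (U ∩ Ici 0) with hτ
  by_cases hnull : F.law U = 0
  · left; rw [Measure.restrict_eq_zero.2 hnull, integral_zero_measure]
  right
  have hex : ∃ u ∈ U, u ∈ F.supp := by
    by_contra h
    push Not at h
    exact hnull (measure_mono_null (fun v hv => h v hv) (ae_iff.1 F.ae_mem_supp))
  obtain ⟨u, huU, hu⟩ := hex
  have hu0 := (pos_of_mem_supp hu).le
  rcases le_or_gt τ F.lo with hle | hlt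
  · left
    refine ⟨⟨u, huU, hu⟩, hle, ?_⟩
    have hset : (U : Set ℝ) =ᵐ[F.law] univ := by
      filter_upwards [F.ae_mem_supp] with v hv
      exact propext ⟨fun _ => trivial, fun _ => mem_of_sInf_lt hU huU hu0 (hle.trans_lt hv.1)⟩
    rw [setIntegral_congr_set hset, Measure.restrict_univ,
      integral_sub F.integrable_ironed (integrable_const _), F.integral_ironed]
    simp
  · right
    have hτs : τ ∈ F.supp := Ioc_lo_subset_supp hu ⟨hlt, sInf_le_of_mem huU hu0⟩
    refine ⟨τ, hτs, fun s _ h => mem_of_sInf_lt hU huU hu0 h, fun s hs hsτ hsU =>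
      absurd (sInf_le_of_mem hsU (pos_of_mem_supp hs).le) (not_le.2 hsτ), ?_⟩
    have hset : (U : Set ℝ) =ᵐ[F.law] Ioi τ := by
      have hae : ∀ᵐ t ∂F.law, t ≠ τ := by simp [ae_iff]
      filter_upwards [F.ae_mem_supp, hae] with v hv hne
      exact propext ⟨fun h => (sInf_le_of_mem h (pos_of_mem_supp hv).le).lt_of_ne hne.symm,
        fun h => mem_of_sInf_lt hU huU hu0 h⟩
    rw [setIntegral_congr_set hset, integral_sub F.integrable_ironed.integrableOn
      (integrable_const _), F.setIntegral_ironed hτs, setIntegral_const, F.law_Ioi,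
      F.cumVirtual_cdf hτs, smul_eq_mul]
    ring

theorem integral_gap_indicator_nonneg (hU : IsUpperSet U) :
    0 ≤ ∫ v, F.gap (U.indicator 1) v ∂F.law := by
  rcases integral_gap_indicator_cases (F := F) hU with h | ⟨-, h, h'⟩ | ⟨t, ht, -, -, h⟩
  · exact h.ge
  · rw [h']; linarith
  · rw [h]; linarith [F.convexHull_le (F.cdf_mem_Icc t)]

/-- If the hull were strictly below `cumVirtual` at the threshold, the ironed virtual value would be
constant around it, and `U` would contain points of the support below its own threshold. -/
theorem integral_gap_indicator_eq_zero (hU : IsUpperSet U) (hlo : U ⊆ Ioi F.lo)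
    (hlev : ∀ a ∈ F.supp, ∀ b ∈ F.supp, F.ironed a = F.ironed b → b ∈ U → a ∈ U) :
    ∫ v, F.gap (U.indicator 1) v ∂F.law = 0 := by
  rcases integral_gap_indicator_cases (F := F) hU with h | ⟨⟨u, huU, hu⟩, h, h'⟩ | ⟨t, ht, h1, h2, h⟩
  · exact h
  · have : F.lo ≤ sInf (U ∩ Ici 0) :=
      le_csInf ⟨u, huU, (pos_of_mem_supp hu).le⟩ fun b hb => (hlo hb.1).le
    rw [h']; linarith
  · rcases (F.convexHull_le (F.cdf_mem_Icc t)).lt_or_eq with hlt | heq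
    · obtain ⟨a, ha, b, hb, hat, htb, hab⟩ := F.ironed_const_near ht hlt
      exact absurd (hlev a ha b hb hab (h1 b hb htb)) (h2 a ha hat)
    · rw [h, heq, sub_self]

/-! ### Approximation of monotone rules by mixtures of threshold rules. -/

/-- The allocation rule `x` rounded down to multiples of `1 / m`. -/
def roundDown (m : ℕ) (x : ℝ → ℝ) (t : ℝ) : ℝ :=
  ∑ j ∈ Finset.Icc 1 m, (1 / m : ℝ) * {t | (j : ℝ) ≤ m * x t}.indicator (1 : ℝ → ℝ) t

theorem isUpperSet_level (hx : Monotone x) (m j : ℕ) : IsUpperSet {t | (j : ℝ) ≤ m * x t} :=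
  fun _ _ hab ha => le_trans (show (j : ℝ) ≤ _ from ha)
    (mul_le_mul_of_nonneg_left (hx hab) m.cast_nonneg)

theorem roundDown_eq {m : ℕ} (h0 : ∀ t, 0 ≤ x t) (h1 : ∀ t, x t ≤ 1) (t : ℝ) :
    roundDown m x t = (1 / m : ℝ) * ⌊m * x t⌋₊ := by
  rw [roundDown, ← Finset.mul_sum]
  congr 1
  have hnn : 0 ≤ m * x t := mul_nonneg m.cast_nonneg (h0 t)
  have hle : ⌊m * x t⌋₊ ≤ m := by
    exact (Nat.floor_mono (mul_le_of_le_one_right m.cast_nonneg (h1 t))).trans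
      (Nat.floor_natCast (R := ℝ) m).le
  simp only [indicator_apply, mem_ofPred_eq, Pi.one_apply]
  rw [Finset.sum_boole]
  have : Finset.filter (fun j : ℕ => (j : ℝ) ≤ m * x t) (Finset.Icc 1 m)
      = Finset.Icc 1 ⌊m * x t⌋₊ := by
    ext j
    simp only [Finset.mem_filter, Finset.mem_Icc, ← Nat.le_floor_iff hnn]
    omega
  rw [this]; simp

theorem abs_sub_roundDown_le {m : ℕ} (hm : 0 < m) (h0 : ∀ t, 0 ≤ x t) (h1 : ∀ t, x t ≤ 1) (t : ℝ) :
    |x t - roundDown m x t| ≤ 1 / m := by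
  rw [roundDown_eq h0 h1]
  have hm' : (0 : ℝ) < m := by exact_mod_cast hm
  have ha := Nat.floor_le (mul_nonneg hm'.le (h0 t))
  have hb := Nat.lt_floor_add_one (m * x t)
  have : x t - 1 / m * ⌊m * x t⌋₊ = (m * x t - ⌊m * x t⌋₊) / m := by field_simp
  rw [this, abs_div, abs_of_pos hm']
  exact div_le_div_of_nonneg_right (abs_le.2 ⟨by linarith, by linarith⟩) hm'.le

theorem intervalIntegrable_roundDown (hx : Monotone x) (m : ℕ) (a b : ℝ) :
    IntervalIntegrable (roundDown m x) volume a b := by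
  have : roundDown m x = ∑ j ∈ Finset.Icc 1 m,
      fun t => (1 / m : ℝ) * {t | (j : ℝ) ≤ m * x t}.indicator (1 : ℝ → ℝ) t := by
    ext t; simp [roundDown]
  rw [this]
  exact IntervalIntegrable.sum _ fun j _ =>
    (monotone_indicator_one (isUpperSet_level hx m j)).intervalIntegrable.const_mul _

theorem gap_roundDown (hx : Monotone x) (m : ℕ) (v : ℝ) :
    F.gap (roundDown m x) v
      = ∑ j ∈ Finset.Icc 1 m, (1 / m : ℝ) * F.gap ({t | (j : ℝ) ≤ m * x t}.indicator 1) v := by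
  have h : ∫ t in (0 : ℝ)..v, roundDown m x t = ∑ j ∈ Finset.Icc 1 m,
      (1 / m : ℝ) * ∫ t in (0 : ℝ)..v, {t | (j : ℝ) ≤ m * x t}.indicator (1 : ℝ → ℝ) t := by
    simp only [roundDown]
    rw [intervalIntegral.integral_finsetSum fun j _ =>
      (monotone_indicator_one (isUpperSet_level hx m j)).intervalIntegrable.const_mul _]
    simp only [intervalIntegral.integral_const_mul]
  rw [gap, h, roundDown]
  simp only [gap, Finset.mul_sum, ← Finset.sum_sub_distrib]
  exact Finset.sum_congr rfl fun j _ => by ring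

theorem integrable_gap_level (hx : Monotone x) (m j : ℕ) :
    Integrable (F.gap ({t | (j : ℝ) ≤ m * x t}.indicator 1)) F.law :=
  integrable_gap (monotone_indicator_one (isUpperSet_level hx m j))
    (fun t => indicator_nonneg (fun _ _ => zero_le_one) t)
    (fun t => indicator_le_self' (fun _ _ => zero_le_one) t)

theorem integral_gap_roundDown (hx : Monotone x) (m : ℕ) :
    ∫ v, F.gap (roundDown m x) v ∂F.law = ∑ j ∈ Finset.Icc 1 m,
      (1 / m : ℝ) * ∫ v, F.gap ({t | (j : ℝ) ≤ m * x t}.indicator 1) v ∂F.law := by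
  simp_rw [gap_roundDown hx]
  rw [integral_finsetSum _ fun j _ => (integrable_gap_level hx m j).const_mul _]
  simp only [integral_const_mul]

theorem abs_integral_gap_sub_le (hx : Monotone x) (h0 : ∀ t, 0 ≤ x t) (h1 : ∀ t, x t ≤ 1) {m : ℕ}
    (hm : 0 < m) :
    |∫ v, F.gap x v ∂F.law - ∫ v, F.gap (roundDown m x) v ∂F.law|
      ≤ (∫ v, (|F.ironed v| + 2 * v) ∂F.law) * (1 / m) := by
  have hi : Integrable (F.gap (roundDown m x)) F.law := by
    have : F.gap (roundDown m x) = fun v => ∑ j ∈ Finset.Icc 1 m,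
        (1 / m : ℝ) * F.gap ({t | (j : ℝ) ≤ m * x t}.indicator 1) v :=
      funext fun v => gap_roundDown hx m v
    rw [this]
    exact integrable_finsetSum _ fun j _ => (integrable_gap_level hx m j).const_mul _
  rw [← integral_sub (integrable_gap hx h0 h1) hi, ← integral_mul_const]
  refine norm_integral_le_of_norm_le (f := fun v => F.gap x v - F.gap (roundDown m x) v)
    ((F.integrable_ironed.abs.add (F.integrable_id_law.const_mul 2)).mul_const _) ?_
  filter_upwards [F.ae_mem_supp] with v hv
  exact abs_gap_sub_gap_le hx (intervalIntegrable_roundDown hx m)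
    (abs_sub_roundDown_le hm h0 h1) (pos_of_mem_supp hv).le

theorem tendsto_integral_gap_roundDown (hx : Monotone x) (h0 : ∀ t, 0 ≤ x t) (h1 : ∀ t, x t ≤ 1) :
    Tendsto (fun m : ℕ => ∫ v, F.gap (roundDown m x) v ∂F.law) atTop
      (𝓝 (∫ v, F.gap x v ∂F.law)) := by
  rw [tendsto_iff_dist_tendsto_zero]
  refine squeeze_zero' (Eventually.of_forall fun _ => dist_nonneg) ?_
    (show Tendsto (fun m : ℕ => (∫ v, (|F.ironed v| + 2 * v) ∂F.law) * (1 / (m : ℝ))) atTop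
      (𝓝 0) by
        have := (tendsto_one_div_atTop_nhds_zero_nat (𝕜 := ℝ)).const_mul
          (∫ v, (|F.ironed v| + 2 * v) ∂F.law)
        rwa [mul_zero] at this)
  filter_upwards [eventually_gt_atTop 0] with m hm
  rw [dist_comm, Real.dist_eq]
  exact abs_integral_gap_sub_le hx h0 h1 hm

/-- Auctions are constrained only at nonnegative bids. Extending the rule constantly to negative
bids makes it monotone on the whole line, and payments only integrate it over `[0, v]`. -/
theorem gap_comp_max {v : ℝ} (hv : 0 ≤ v) : F.gap (fun t => x (max 0 t)) v = F.gap x v := by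
  have : ∫ t in (0 : ℝ)..v, x (max 0 t) = ∫ t in (0 : ℝ)..v, x t :=
    intervalIntegral.integral_congr fun t ht => by
      rw [uIcc_of_le hv] at ht
      simp [max_eq_right ht.1]
  rw [gap, gap, this, max_eq_right hv]

theorem integral_gap_comp_max :
    ∫ v, F.gap (fun t => x (max 0 t)) v ∂F.law = ∫ v, F.gap x v ∂F.law :=
  integral_congr_ae (by
    filter_upwards [F.ae_mem_supp] with v hv using gap_comp_max (pos_of_mem_supp hv).le)

theorem monotone_comp_max (hx : MonotoneOn x (Ici 0)) : Monotone fun t => x (max 0 t) :=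
  fun _ _ hab => hx (mem_Ici.2 (le_max_left _ _)) (mem_Ici.2 (le_max_left _ _))
    (max_le_max_left 0 hab)

/-- The expected payment of a bidder is at most the expected ironed virtual surplus. -/
theorem integral_gap_nonneg (hx : MonotoneOn x (Ici 0)) (h0 : ∀ t, 0 ≤ t → 0 ≤ x t)
    (h1 : ∀ t, 0 ≤ t → x t ≤ 1) : 0 ≤ ∫ v, F.gap x v ∂F.law := by
  rw [← integral_gap_comp_max]
  have hm := monotone_comp_max hx
  refine ge_of_tendsto' (tendsto_integral_gap_roundDown hm (fun t => h0 _ (le_max_left _ _))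
    fun t => h1 _ (le_max_left _ _)) fun m => ?_
  rw [integral_gap_roundDown hm]
  exact Finset.sum_nonneg fun j _ => mul_nonneg (by positivity)
    (integral_gap_indicator_nonneg (isUpperSet_level hm m j))

/-- The expected payment equals the expected ironed virtual surplus if the allocation only depends
on the ironed virtual value. -/
theorem integral_gap_eq_zero (hx : MonotoneOn x (Ici 0)) (h0 : ∀ t, 0 ≤ t → 0 ≤ x t)
    (h1 : ∀ t, 0 ≤ t → x t ≤ 1) (hlo : ∀ t ≤ F.lo, x t = 0)
    (hlev : ∀ a ∈ F.supp, ∀ b ∈ F.supp, F.ironed a = F.ironed b → x a = x b) :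
    ∫ v, F.gap x v ∂F.law = 0 := by
  rw [← integral_gap_comp_max]
  have hm := monotone_comp_max hx
  refine tendsto_nhds_unique (tendsto_integral_gap_roundDown hm (fun t => h0 _ (le_max_left _ _))
    fun t => h1 _ (le_max_left _ _)) ?_
  refine (tendsto_const_nhds (x := (0 : ℝ))).congr fun m => ?_
  rw [integral_gap_roundDown hm]
  refine (Finset.sum_eq_zero fun j hj => ?_).symm
  rw [integral_gap_indicator_eq_zero (isUpperSet_level hm m j), mul_zero]
  -- Levels start at `j = 1`, so a rule that vanishes up to `lo` has all its level sets above `lo`.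
  · intro t ht
    by_contra hle
    have hx0 := hlo (max 0 t) (max_le F.lo_nonneg (not_lt.1 hle))
    rw [mem_ofPred_eq, hx0, mul_zero] at ht
    have : j ≤ 0 := by exact_mod_cast ht
    have := (Finset.mem_Icc.1 hj).1
    omega
  · intro a ha b hb hab hbU
    rw [mem_ofPred_eq, max_eq_right (pos_of_mem_supp hb).le, ← hlev a ha b hb hab] at hbU
    rwa [mem_ofPred_eq, max_eq_right (pos_of_mem_supp ha).le]

end ValueDist

/-! ### A lower bound on the benchmark -/

theorem exists_top_subset {ι β : Type*} [DecidableEq ι] [LinearOrder β] (f : ι → β) (s : Finset ι)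
    (m : ℕ) (hm : m ≤ s.card) :
    ∃ W ⊆ s, W.card = m ∧ ∀ i ∈ W, ∀ j ∈ s, j ∉ W → f j ≤ f i := by
  induction m with
  | zero => exact ⟨∅, Finset.empty_subset _, rfl, by simp⟩
  | succ m ih =>
    obtain ⟨W, hWs, hWc, hW⟩ := ih (by omega)
    have hne : (s \ W).Nonempty := by
      rw [← Finset.card_pos, Finset.card_sdiff_of_subset hWs]; omega
    obtain ⟨a, ha, hmax⟩ := Finset.exists_max_image (s \ W) f hne
    rw [Finset.mem_sdiff] at ha
    refine ⟨insert a W, Finset.insert_subset ha.1 hWs, by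
      rw [Finset.card_insert_of_notMem ha.2, hWc], ?_⟩
    intro i hi j hj hjW
    rw [Finset.mem_insert, not_or] at hjW
    rcases Finset.mem_insert.1 hi with rfl | hi
    · exact hmax j (Finset.mem_sdiff.2 ⟨hj, hjW.2⟩)
    · exact hW i hi j hj hjW.2

section Benchmark

variable {n k : ℕ} {v p θ : Fin n → ℝ}

theorem min_le_secondHighest {i j : Fin n} (hij : i ≠ j) : min (v i) (v j) ≤ secondHighest v := by
  refine le_csSup (Set.Finite.bddAbove ?_) ⟨i, j, hij, rfl⟩
  refine (Set.finite_range fun p : Fin n × Fin n => min (v p.1) (v p.2)).subset ?_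
  rintro x ⟨i, j, -, rfl⟩
  exact ⟨(i, j), rfl⟩

theorem secondHighest_nonneg (hv : ∀ i, 0 ≤ v i) : 0 ≤ secondHighest v := by
  refine Real.sSup_nonneg ?_
  rintro x ⟨i, j, -, rfl⟩
  exact le_min (hv i) (hv j)

theorem bddAbove_benchmark_set (k : ℕ) (hv : ∀ i, 0 ≤ v i) :
    BddAbove {r | ∃ p : Fin n → ℝ, FeasiblePrices k v p ∧ ∃ D : Finset (Fin n),
      (∀ i ∈ D, v i = p i) ∧ (Finset.univ.filter fun i => p i < v i).card + D.card ≤ k ∧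
      r = ∑ i ∈ Finset.univ.filter (fun i => p i < v i), p i + ∑ i ∈ D, p i} := by
  refine ⟨∑ i, v i + ∑ i, v i, ?_⟩
  rintro r ⟨p, -, D, hD, -, rfl⟩
  refine add_le_add ?_ ?_
  · refine (Finset.sum_le_sum fun i hi => (Finset.mem_filter.1 hi).2.le).trans ?_
    exact Finset.sum_le_sum_of_subset_of_nonneg (Finset.subset_univ _) fun i _ _ => hv i
  · refine (Finset.sum_le_sum fun i hi => (hD i hi).ge).trans ?_
    exact Finset.sum_le_sum_of_subset_of_nonneg (Finset.subset_univ _) fun i _ _ => hv i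

/-- The members of `K` strictly above their price are the compulsory buyers; the others have
valuation equal to price and serve as the set `D`. -/
theorem sum_le_benchmark_of_winners (hv : ∀ i, 0 ≤ v i) (hmono : ∀ i j, i ≤ j → p j ≤ p i)
    (hsec : ∀ i, p i ≤ secondHighest v) {K : Finset (Fin n)} (hK : K.card ≤ k)
    (hpv : ∀ i ∈ K, p i ≤ v i) (hwin : ∀ i, p i < v i → i ∈ K) :
    ∑ i ∈ K, p i ≤ benchmark k v := by
  have hfilter : Finset.univ.filter (fun i => p i < v i) = K.filter fun i => p i < v i := by
    ext i
    simp only [Finset.mem_filter, Finset.mem_univ, true_and]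
    exact ⟨fun h => ⟨hwin i h, h⟩, fun h => h.2⟩
  have hcard := Finset.card_filter_add_card_filter_not (s := K) (fun i => p i < v i)
  have hsum := Finset.sum_filter_add_sum_filter_not K (fun i => p i < v i) p
  refine le_csSup (bddAbove_benchmark_set k hv) ⟨p, ⟨hmono, hsec, ?_⟩,
    K.filter fun i => ¬ p i < v i, fun i hi => ?_, ?_, ?_⟩
  · rw [hfilter]; omega
  · rw [Finset.mem_filter] at hi
    exact le_antisymm (not_lt.1 hi.2) (hpv i hi.1)
  · rw [hfilter]; omega
  · rw [hfilter, hsum]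

/-- Monotone prices that are at most the second-highest valuation can be raised so that the
benchmark collects at least the total price of any `k` bidders who can afford it. -/
theorem sum_le_benchmark (hk : 2 ≤ k) (hv : ∀ i, 0 ≤ v i) (hmono : ∀ i j, i ≤ j → θ j ≤ θ i)
    (h0 : ∀ i, 0 ≤ θ i) (hsec : ∀ i, θ i ≤ secondHighest v) {W : Finset (Fin n)}
    (hW : W.card ≤ k) (hWv : ∀ i ∈ W, θ i ≤ v i) : ∑ i ∈ W, θ i ≤ benchmark k v := by
  classical
  set Q := Finset.univ.filter fun i => θ i ≤ v i with hQ
  have hmemQ : ∀ i, i ∈ Q ↔ θ i ≤ v i := fun i => by simp [hQ]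
  have hWQ : W ⊆ Q := fun i hi => (hmemQ i).2 (hWv i hi)
  -- If at most `k` bidders can afford `θ`, these prices are feasible as they stand. Otherwise every
  -- price is raised to at least the lowest valuation among the top `k` members of `Q`.
  rcases le_total Q.card k with hQk | hkQ
  · calc ∑ i ∈ W, θ i ≤ ∑ i ∈ Q, θ i :=
          Finset.sum_le_sum_of_subset_of_nonneg hWQ fun i _ _ => h0 i
      _ ≤ benchmark k v := sum_le_benchmark_of_winners hv hmono hsec hQk
          (fun i hi => (hmemQ i).1 hi) fun i hi => (hmemQ i).2 hi.le
  · obtain ⟨K, hKQ, hKc, hK⟩ := exists_top_subset v Q k hkQ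
    have hKne : K.Nonempty := by rw [← Finset.card_pos]; omega
    obtain ⟨a, ha, hmin⟩ := Finset.exists_min_image K v hKne
    obtain ⟨b, hb, hba⟩ := Finset.exists_mem_ne (by omega : 1 < K.card) a
    -- This is where `2 ≤ k` matters: a second member of `K` has valuation at least `v a`.
    have hr : v a ≤ secondHighest v := by
      rw [← min_eq_left (hmin b hb)]
      exact min_le_secondHighest hba.symm
    have hmain := sum_le_benchmark_of_winners (k := k) (p := fun i => max (θ i) (v a)) (K := K) hv
      (fun i j hij => max_le_max_right _ (hmono i j hij)) (fun i => max_le (hsec i) hr) hKc.le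
      (fun i hi => max_le ((hmemQ i).1 (hKQ hi)) (hmin i hi)) (fun i hi => by
        by_contra hiK
        have h1 := (le_max_left _ _).trans_lt hi
        have h2 := (le_max_right _ _).trans_lt hi
        exact absurd (hK a ha i ((hmemQ i).2 h1.le) hiK) (not_le.2 h2))
    refine le_trans ?_ hmain
    -- Bidders of `W` outside `K` have `θ i ≤ v a`; at least as many members of `K \ W` pay at least
    -- `v a` in their place.
    have hcard : (W \ K).card ≤ (K \ W).card := by
      have h1 := Finset.card_sdiff_add_card_inter W K
      have h2 := Finset.card_sdiff_add_card_inter K W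
      rw [Finset.inter_comm] at h2
      omega
    have hWK : ∑ i ∈ W \ K, θ i ≤ (W \ K).card • v a := Finset.sum_le_card_nsmul _ _ _ fun i hi => by
      rw [Finset.mem_sdiff] at hi
      exact (hWv i hi.1).trans (hK a ha i (hWQ hi.1) hi.2)
    have hKW : (K \ W).card • v a ≤ ∑ i ∈ K \ W, max (θ i) (v a) :=
      Finset.card_nsmul_le_sum _ _ _ fun i _ => le_max_right _ _
    have hmid : (W \ K).card • v a ≤ (K \ W).card • v a := nsmul_le_nsmul_left (hv a) hcard
    have hinter : ∑ i ∈ W ∩ K, θ i ≤ ∑ i ∈ K ∩ W, max (θ i) (v a) := by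
      rw [Finset.inter_comm]
      exact Finset.sum_le_sum fun i _ => le_max_left _ _
    rw [← Finset.sum_inter_add_sum_sdiff W K, ← Finset.sum_inter_add_sum_sdiff K W]
    linarith

theorem benchmark_nonneg (hk : 2 ≤ k) (hv : ∀ i, 0 ≤ v i) : 0 ≤ benchmark k v := by
  simpa using sum_le_benchmark (θ := fun _ => 0) (W := ∅) hk hv (fun _ _ _ => le_rfl)
    (fun _ => le_rfl) (fun _ => secondHighest_nonneg hv) (by simp) (by simp)

end Benchmark

/-! ### Selling to the highest positive levels with random tie-breaking -/

section Top

variable {n k : ℕ} {L : Fin n → EReal} {i j : Fin n} {W : Finset (Fin n)}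

open Classical in
/-- The sets of (at most `k`) indices with the highest positive levels. -/
def topSets (k : ℕ) (L : Fin n → EReal) : Finset (Finset (Fin n)) :=
  Finset.univ.filter fun W =>
    (∀ i ∈ W, 0 < L i) ∧ W.card = min k (Finset.univ.filter fun i => 0 < L i).card ∧
    ∀ i ∈ W, ∀ j ∉ W, L j ≤ L i

/-- The probability that `i` belongs to a uniformly random element of `topSets k L`. -/
def share (k : ℕ) (L : Fin n → EReal) (i : Fin n) : ℝ :=
  ((topSets k L).filter fun W => i ∈ W).card / (topSets k L).card

open Classical in
theorem mem_topSets : W ∈ topSets k L ↔ (∀ i ∈ W, 0 < L i) ∧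
    W.card = min k (Finset.univ.filter fun i => 0 < L i).card ∧
    ∀ i ∈ W, ∀ j ∉ W, L j ≤ L i := by
  simp [topSets]

theorem topSets_nonempty (k : ℕ) (L : Fin n → EReal) : (topSets k L).Nonempty := by
  classical
  obtain ⟨W, hWs, hWc, hW⟩ := exists_top_subset L (Finset.univ.filter fun i => 0 < L i)
    (min k (Finset.univ.filter fun i => 0 < L i).card) (min_le_right _ _)
  have hpos : ∀ i ∈ W, 0 < L i := fun i hi => (Finset.mem_filter.1 (hWs hi)).2
  refine ⟨W, mem_topSets.2 ⟨hpos, hWc, fun i hi j hj => ?_⟩⟩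
  by_cases h : 0 < L j
  · exact hW i hi j (by simp [h]) hj
  · exact (not_lt.1 h).trans (hpos i hi).le

theorem card_le_of_mem_topSets (hW : W ∈ topSets k L) : W.card ≤ k := by
  rw [(mem_topSets.1 hW).2.1]; exact min_le_left _ _

theorem card_eq_of_notMem (hW : W ∈ topSets k L) (hi : 0 < L i) (hiW : i ∉ W) : W.card = k := by
  classical
  obtain ⟨h1, h2, -⟩ := mem_topSets.1 hW
  have : W.card < (Finset.univ.filter fun i => 0 < L i).card := by
    refine Finset.card_lt_card ⟨fun a ha => by simpa using h1 a ha, fun h => hiW (h ?_)⟩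
    simpa using hi
  omega

theorem card_topSets_pos (k : ℕ) (L : Fin n → EReal) : (0 : ℝ) < (topSets k L).card := by
  exact_mod_cast (topSets_nonempty k L).card_pos

theorem share_nonneg (k : ℕ) (L : Fin n → EReal) (i : Fin n) : 0 ≤ share k L i := by
  unfold share; positivity

theorem share_le_one (k : ℕ) (L : Fin n → EReal) (i : Fin n) : share k L i ≤ 1 := by
  rw [share, div_le_one (card_topSets_pos k L)]
  exact_mod_cast Finset.card_filter_le _ _

theorem share_pos_iff : 0 < share k L i ↔ ∃ W ∈ topSets k L, i ∈ W := by
  rw [share, div_pos_iff_of_pos_right (card_topSets_pos k L), Nat.cast_pos, Finset.card_pos]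
  simp [Finset.Nonempty]

theorem share_eq_one_iff : share k L i = 1 ↔ ∀ W ∈ topSets k L, i ∈ W := by
  rw [share, div_eq_one_iff_eq (card_topSets_pos k L).ne', Nat.cast_inj,
    Finset.card_filter_eq_iff]

theorem pos_of_share_pos (h : 0 < share k L i) : 0 < L i := by
  obtain ⟨W, hW, hi⟩ := share_pos_iff.1 h
  exact (mem_topSets.1 hW).1 i hi

theorem sum_share_mul (k : ℕ) (L : Fin n → EReal) (a : Fin n → ℝ) :
    ∑ i, share k L i * a i = (∑ W ∈ topSets k L, ∑ i ∈ W, a i) / (topSets k L).card := by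
  classical
  have h : ∀ i, share k L i * a i
      = (∑ W ∈ topSets k L, if i ∈ W then a i else 0) / (topSets k L).card := by
    intro i
    rw [share, Finset.sum_ite, Finset.sum_const_zero, add_zero, Finset.sum_const, nsmul_eq_mul]
    ring
  simp_rw [h]
  rw [← Finset.sum_div, Finset.sum_comm]
  congr 1
  refine Finset.sum_congr rfl fun W _ => ?_
  rw [Finset.sum_ite_mem, Finset.univ_inter]

/-- Exchange argument: a winner set `W'` that omits `i` after the increase is full, so it has a
member `m` outside a former winner set `W` containing `i`. Then `W` gives `L m ≤ L i`, while `W'`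
gives `y ≤ L m`. -/
theorem share_update_of_lt {y : EReal} (hy : L i < y) (h : 0 < share k L i) :
    share k (Function.update L i y) i = 1 := by
  classical
  obtain ⟨W, hW, hiW⟩ := share_pos_iff.1 h
  have hpos := (mem_topSets.1 hW).1 i hiW
  refine share_eq_one_iff.2 fun W' hW' => ?_
  by_contra hi
  have hc := card_eq_of_notMem (i := i) hW' (by simpa using hpos.trans hy) hi
  have hnot : ¬ W' ⊆ W := by
    intro hsub
    have := Finset.card_le_card (Finset.insert_subset hiW hsub)
    rw [Finset.card_insert_of_notMem hi, hc] at this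
    have := card_le_of_mem_topSets hW
    omega
  obtain ⟨m, hm', hm⟩ := Finset.not_subset.1 hnot
  have hmi : m ≠ i := fun h => hm (h ▸ hiW)
  have h1 := (mem_topSets.1 hW').2.2 m hm' i hi
  rw [Function.update_self, Function.update_of_ne hmi] at h1
  exact absurd ((mem_topSets.1 hW).2.2 i hiW m hm) (not_le.2 (hy.trans_le h1))

/-- A positive share jumps to one as soon as the level strictly increases. -/
theorem monotone_share_update (k : ℕ) (L : Fin n → EReal) (i : Fin n) :
    Monotone fun y => share k (Function.update L i y) i := by
  intro y z hyz
  rcases hyz.eq_or_lt with rfl | hlt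
  · exact le_rfl
  rcases (share_nonneg k (Function.update L i y) i).eq_or_lt with h | h
  · exact h.symm.le.trans (share_nonneg _ _ _)
  · have := share_update_of_lt (y := z) (by simpa using hlt) h
    rw [Function.update_idem] at this
    exact (share_le_one _ _ _).trans this.ge

/-- Otherwise a winner set omitting `j` is full and has only levels at least `L j`, which exceeds `L
i`. One of its members is missing from a winner set containing `i`, although its level is higher. -/
theorem level_le_of_share (hi : 0 < share k L i) (hj : share k L j < 1) (hj0 : 0 < L j) :
    L j ≤ L i := by
  classical
  by_contra hlt
  rw [not_le] at hlt
  have hex : ∃ W ∈ topSets k L, j ∉ W := by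
    by_contra h
    push Not at h
    exact hj.ne (share_eq_one_iff.2 h)
  obtain ⟨W, hW, hjW⟩ := hex
  obtain ⟨W2, hW2, hiW2⟩ := share_pos_iff.1 hi
  have hc := card_eq_of_notMem hW hj0 hjW
  have hge : ∀ m ∈ W, L j ≤ L m := fun m hm => (mem_topSets.1 hW).2.2 m hm j hjW
  have hiW : i ∉ W := fun h => absurd (hge i h) (not_le.2 hlt)
  have hnot : ¬ W ⊆ W2 := by
    intro hsub
    have := Finset.card_le_card (Finset.insert_subset hiW2 hsub)
    rw [Finset.card_insert_of_notMem hiW, hc] at this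
    have := card_le_of_mem_topSets hW2
    omega
  obtain ⟨m, hm, hm2⟩ := Finset.not_subset.1 hnot
  exact absurd ((hge m hm).trans ((mem_topSets.1 hW2).2.2 i hiW2 m hm2)) (not_le.2 hlt)

theorem level_eq_of_share (hi : 0 < share k L i) (hi1 : share k L i < 1) (hj : 0 < share k L j)
    (hj1 : share k L j < 1) : L i = L j :=
  le_antisymm (level_le_of_share hj hi1 (pos_of_share_pos hi))
    (level_le_of_share hi hj1 (pos_of_share_pos hj))

/-- A sure winner who lowers its level, but not below that of some sure winner, wins for sure. -/
theorem share_update_eq_one {y : EReal} (hi : share k L i = 1) (hj : share k L j = 1)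
    (hy : L j ≤ y) : share k (Function.update L i y) i = 1 := by
  classical
  have hposj : 0 < L j := pos_of_share_pos (by rw [hj]; exact one_pos)
  refine share_eq_one_iff.2 fun W' hW' => ?_
  by_contra hiW'
  have hc := card_eq_of_notMem (i := i) hW' (by simpa using hposj.trans_le hy) hiW'
  obtain ⟨W, hW⟩ := topSets_nonempty k L
  have hiW := share_eq_one_iff.1 hi W hW
  have hjW := share_eq_one_iff.1 hj W hW
  have hnot : ¬ W' ⊆ W := by
    intro hsub
    have := Finset.card_le_card (Finset.insert_subset hiW hsub)
    rw [Finset.card_insert_of_notMem hiW', hc] at this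
    have := card_le_of_mem_topSets hW
    omega
  obtain ⟨m, hm', hm⟩ := Finset.not_subset.1 hnot
  obtain ⟨hpos, hcard, hdom⟩ := mem_topSets.1 hW
  have hmi : m ≠ i := fun h => hm (h ▸ hiW)
  have hmj : m ≠ j := fun h => hm (h ▸ hjW)
  have h1 := (mem_topSets.1 hW').2.2 m hm' i hiW'
  rw [Function.update_self, Function.update_of_ne hmi] at h1
  -- Since `m` ties with `j`, exchanging the two yields a winner set without `j`, contradicting that
  -- `j` wins for sure.
  have heq : L m = L j := le_antisymm (hdom j hjW m hm) (hy.trans h1)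
  have hswap : insert m (W.erase j) ∈ topSets k L := by
    refine mem_topSets.2 ⟨fun a ha => ?_, ?_, fun a ha b hb => ?_⟩
    · rcases Finset.mem_insert.1 ha with rfl | ha
      · rw [heq]; exact hposj
      · exact hpos a (Finset.mem_of_mem_erase ha)
    · rw [Finset.card_insert_of_notMem fun h => hm (Finset.mem_of_mem_erase h),
        Finset.card_erase_add_one hjW, hcard]
    · rw [Finset.mem_insert, not_or, Finset.mem_erase, not_and] at hb
      have hbj : L b ≤ L j := by
        by_cases h : b = j
        · rw [h]
        · exact hdom j hjW b (hb.2 h)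
      rcases Finset.mem_insert.1 ha with rfl | ha
      · rw [heq]; exact hbj
      · exact hbj.trans (heq ▸ hdom a (Finset.mem_of_mem_erase ha) m hm)
  have := share_eq_one_iff.1 hj _ hswap
  rw [Finset.mem_insert] at this
  rcases this with h | h
  · exact hmj h.symm
  · exact Finset.notMem_erase j W h

/-- Lagrangian bound: `m` is a price per unit that separates the levels in `W` from those outside.
It is zero if no positive level is left out, and otherwise the lowest level in `W`, all `k` units
then being sold. -/
theorem sum_mul_le_of_mem_topSets {ℓ x : Fin n → ℝ} (h0 : ∀ i, 0 ≤ x i) (h1 : ∀ i, x i ≤ 1)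
    (hs : ∑ i, x i ≤ k) (hW : W ∈ topSets k fun i => (ℓ i : EReal)) :
    ∑ i, ℓ i * x i ≤ ∑ i ∈ W, ℓ i := by
  classical
  obtain ⟨hpos, -, hdom⟩ := mem_topSets.1 hW
  have hposW : ∀ i ∈ W, 0 < ℓ i := fun i hi => EReal.coe_pos.1 (hpos i hi)
  obtain ⟨m, hm0, hmW, hmo, hmk⟩ : ∃ m : ℝ, 0 ≤ m ∧ (∀ i ∈ W, m ≤ ℓ i) ∧ (∀ i ∉ W, ℓ i ≤ m) ∧
      m * ∑ i, x i ≤ m * W.card := by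
    by_cases hex : ∃ i ∉ W, 0 < ℓ i
    · obtain ⟨i, hi, hi0⟩ := hex
      have hc := card_eq_of_notMem hW (EReal.coe_pos.2 hi0) hi
      -- An empty full winner set means `k = 0`; then `x` vanishes and any large `m` works.
      rcases W.eq_empty_or_nonempty with rfl | hne
      · have hx : ∑ i, x i = 0 := le_antisymm
          (hs.trans (by rw [← hc]; simp)) (Finset.sum_nonneg fun i _ => h0 i)
        refine ⟨∑ i, |ℓ i|, Finset.sum_nonneg fun _ _ => abs_nonneg _, by simp, fun i _ => ?_, ?_⟩
        · exact (le_abs_self _).trans (Finset.single_le_sum (f := fun i => |ℓ i|)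
            (fun _ _ => abs_nonneg _) (Finset.mem_univ i))
        · rw [hx]; simp
      · obtain ⟨a, ha, hmin⟩ := Finset.exists_min_image W ℓ hne
        refine ⟨ℓ a, (hposW a ha).le, hmin, fun i hi => EReal.coe_le_coe_iff.1 (hdom a ha i hi), ?_⟩
        rw [hc]
        exact mul_le_mul_of_nonneg_left hs (hposW a ha).le
    · push Not at hex
      exact ⟨0, le_rfl, fun i hi => (hposW i hi).le, hex, by simp⟩
  have h2 : ∑ i, ℓ i * x i = ∑ i, (ℓ i - m) * x i + m * ∑ i, x i := by
    rw [Finset.mul_sum, ← Finset.sum_add_distrib]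
    exact Finset.sum_congr rfl fun i _ => by ring
  have h3 : ∑ i, (ℓ i - m) * x i ≤ ∑ i, if i ∈ W then ℓ i - m else 0 := by
    refine Finset.sum_le_sum fun i _ => ?_
    split_ifs with hi
    · exact mul_le_of_le_one_right (sub_nonneg.2 (hmW i hi)) (h1 i)
    · exact mul_nonpos_of_nonpos_of_nonneg (sub_nonpos.2 (hmo i hi)) (h0 i)
  rw [Finset.sum_ite_mem, Finset.univ_inter, Finset.sum_sub_distrib, Finset.sum_const,
    nsmul_eq_mul] at h3
  linarith

theorem sum_mul_le_sum_mul_share {ℓ x : Fin n → ℝ} (h0 : ∀ i, 0 ≤ x i) (h1 : ∀ i, x i ≤ 1)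
    (hs : ∑ i, x i ≤ k) :
    ∑ i, ℓ i * x i ≤ ∑ i, ℓ i * share k (fun i => (ℓ i : EReal)) i := by
  simp_rw [mul_comm (ℓ _) (share _ _ _)]
  rw [sum_share_mul, le_div_iff₀ (card_topSets_pos _ _), mul_comm, ← nsmul_eq_mul]
  exact Finset.card_nsmul_le_sum _ _ _ fun W hW => sum_mul_le_of_mem_topSets h0 h1 hs hW

end Top

/-! ### The optimal auction -/

section Opt

variable {n k : ℕ} {F : Fin n → ValueDist} {v : Fin n → ℝ} {i : Fin n}

/-- The levels of the bids. -/
def levels (F : Fin n → ValueDist) (v : Fin n → ℝ) (i : Fin n) : EReal := (F i).bidLevel (v i)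

theorem winnerSets_eq : winnerSets F k v = topSets k (levels F v) := rfl

theorem optX_eq : optX F k v i = share k (levels F v) i := by
  rw [optX, share, winnerSets_eq]

theorem levels_update (F : Fin n → ValueDist) (v : Fin n → ℝ) (i : Fin n) (t : ℝ) :
    levels F (Function.update v i t) = Function.update (levels F v) i ((F i).bidLevel t) := by
  ext j
  rcases eq_or_ne j i with rfl | h
  · simp [levels]
  · simp [levels, h]

theorem optX_update (t : ℝ) : optX F k (Function.update v i t) i
    = share k (Function.update (levels F v) i ((F i).bidLevel t)) i := by
  rw [optX_eq, levels_update]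

theorem optX_nonneg (F : Fin n → ValueDist) (k : ℕ) (v : Fin n → ℝ) (i : Fin n) :
    0 ≤ optX F k v i := by rw [optX_eq]; exact share_nonneg _ _ _

theorem optX_le_one (F : Fin n → ValueDist) (k : ℕ) (v : Fin n → ℝ) (i : Fin n) :
    optX F k v i ≤ 1 := by rw [optX_eq]; exact share_le_one _ _ _

theorem monotone_optX_update (F : Fin n → ValueDist) (k : ℕ) (v : Fin n → ℝ) (i : Fin n) :
    Monotone fun t => optX F k (Function.update v i t) i := by
  simp_rw [optX_update]
  exact (monotone_share_update k (levels F v) i).comp (F i).monotone_bidLevel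

theorem optX_update_of_le_lo {t : ℝ} (ht : t ≤ (F i).lo) :
    optX F k (Function.update v i t) i = 0 := by
  rw [optX_update, (F i).bidLevel_of_le_lo ht]
  refine le_antisymm (not_lt.1 fun h => ?_) (share_nonneg _ _ _)
  have := pos_of_share_pos h
  simp at this

theorem intervalIntegrable_optX_update (F : Fin n → ValueDist) (k : ℕ) (v : Fin n → ℝ)
    (i : Fin n) (a b : ℝ) :
    IntervalIntegrable (fun t => optX F k (Function.update v i t) i) volume a b :=
  (monotone_optX_update F k v i).intervalIntegrable

theorem optP_le (hi : 0 ≤ v i) : optP F k v i ≤ v i * optX F k v i :=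
  sub_le_self _ (intervalIntegral.integral_nonneg hi fun _ _ => optX_nonneg _ _ _ _)

theorem optP_nonneg (hi : 0 ≤ v i) : 0 ≤ optP F k v i := by
  have h := intervalIntegral.integral_mono_on hi (intervalIntegrable_optX_update F k v i 0 (v i))
    (intervalIntegrable_const (c := optX F k v i)) fun t ht => by
      have := monotone_optX_update F k v i ht.2
      simpa using this
  rw [intervalIntegral.integral_const, sub_zero, smul_eq_mul] at h
  exact sub_nonneg.2 h

theorem optP_eq (hi : 0 ≤ v i) : optX F k v i * optPrice F k v i = optP F k v i := by
  rcases (optX_nonneg F k v i).eq_or_lt with h | h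
  · rw [← h, zero_mul]
    refine le_antisymm (optP_nonneg hi) ((optP_le hi).trans ?_)
    rw [← h, mul_zero]
  · rw [optPrice, mul_div_cancel₀ _ h.ne']

theorem optPrice_nonneg (hi : 0 ≤ v i) : 0 ≤ optPrice F k v i :=
  div_nonneg (optP_nonneg hi) (optX_nonneg _ _ _ _)

/-- If bidder `i` could lower its bid to `c` without reducing its winning probability, its price is
at most `c`. -/
theorem optPrice_le_of_forall {c : ℝ} (hc : 0 ≤ c) (hcv : c ≤ v i) (hpos : 0 < optX F k v i)
    (h : ∀ t, c < t → t ≤ v i → optX F k v i ≤ optX F k (Function.update v i t) i) :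
    optPrice F k v i ≤ c := by
  have hint := intervalIntegrable_optX_update F k v i
  have h1 := intervalIntegral.integral_add_adjacent_intervals (hint 0 c) (hint c (v i))
  have h2 := intervalIntegral.integral_nonneg hc
    (f := fun t => optX F k (Function.update v i t) i) (μ := volume)
    fun _ _ => optX_nonneg _ _ _ _
  have h3 := intervalIntegral.integral_mono_on_of_le_Ioo hcv
    (intervalIntegrable_const (c := optX F k v i)) (hint c (v i)) fun t ht => h t ht.1 ht.2.le
  rw [intervalIntegral.integral_const, smul_eq_mul] at h3
  rw [optPrice, div_le_iff₀ hpos, optP]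
  linarith

theorem levels_of_mem (hv : (v i) ∈ (F i).supp) : levels F v i = (F i).ironed (v i) :=
  (F i).bidLevel_of_mem hv

/-- Winners who win with at least the same probability at every bid of ironed virtual value at
least `y`, and who pay at most the second-highest valuation, pay in total at most the benchmark. -/
theorem sum_optPrice_le_benchmark (hk : 2 ≤ k) (hF : PointwiseOrdered F)
    (hv : ∀ i, v i ∈ (F i).supp) {y : ℝ} (hy : 0 ≤ y) {U : Finset (Fin n)} (hU : U.card ≤ k)
    (hpos : ∀ i ∈ U, 0 < optX F k v i) (hUy : ∀ i ∈ U, y ≤ (F i).ironed (v i))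
    (hkeep : ∀ i ∈ U, ∀ t ∈ (F i).supp, t ≤ v i → y ≤ (F i).ironed t →
      optX F k v i ≤ optX F k (Function.update v i t) i)
    (hsec : ∀ i ∈ U, optPrice F k v i ≤ secondHighest v) :
    ∑ i ∈ U, optPrice F k v i ≤ benchmark k v := by
  have hv0 : ∀ i, 0 ≤ v i := fun i => (ValueDist.pos_of_mem_supp (hv i)).le
  have hs0 := secondHighest_nonneg hv0
  -- The thresholds are monotone in the index by the pointwise order; the cap preserves this and
  -- removes infinite values.
  set e : Fin n → EReal := fun i => min ((F i).ironedInv y) (secondHighest v) with he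
  have hinv0 : ∀ i, 0 ≤ (F i).ironedInv y := fun i =>
    (EReal.coe_nonneg.2 (F i).lo_nonneg).trans ((F i).lo_le_ironedInv y)
  have he0 : ∀ i, 0 ≤ e i := fun i => le_min (hinv0 i) (EReal.coe_nonneg.2 hs0)
  have hetop : ∀ i, e i ≠ ⊤ := fun i =>
    ((min_le_right _ _).trans_lt (EReal.coe_lt_top _)).ne
  have hebot : ∀ i, e i ≠ ⊥ := fun i => (lt_of_lt_of_le (by simp) (he0 i)).ne'
  have hcoe : ∀ i, ((e i).toReal : EReal) = e i := fun i => EReal.coe_toReal (hetop i) (hebot i)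
  have hle : ∀ i ∈ U, ∃ c : ℝ, (c : EReal) = (F i).ironedInv y ∧ c ≤ v i ∧
      optPrice F k v i ≤ c := by
    intro i hi
    have h1 := (F i).ironedInv_le (hv i) (hUy i hi)
    obtain ⟨c, hc⟩ : ∃ c : ℝ, (c : EReal) = (F i).ironedInv y :=
      ⟨((F i).ironedInv y).toReal, EReal.coe_toReal (h1.trans_lt (EReal.coe_lt_top _)).ne
        (lt_of_lt_of_le (by simp) (hinv0 i)).ne'⟩
    have hcv : c ≤ v i := EReal.coe_le_coe_iff.1 (hc ▸ h1)
    have hloc : (F i).lo ≤ c := EReal.coe_le_coe_iff.1 (hc ▸ (F i).lo_le_ironedInv y)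
    refine ⟨c, hc, hcv, optPrice_le_of_forall ((F i).lo_nonneg.trans hloc) hcv (hpos i hi)
      fun t hct htv => ?_⟩
    have ht : t ∈ (F i).supp := ValueDist.Ioc_lo_subset_supp (hv i) ⟨hloc.trans_lt hct, htv⟩
    exact hkeep i hi t ht htv
      ((F i).le_ironed_of_ironedInv_lt ht (hc ▸ EReal.coe_lt_coe_iff.2 hct))
  calc ∑ i ∈ U, optPrice F k v i ≤ ∑ i ∈ U, (e i).toReal := by
        refine Finset.sum_le_sum fun i hi => ?_
        obtain ⟨c, hc, -, hpc⟩ := hle i hi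
        rw [← EReal.coe_le_coe_iff, hcoe]
        exact le_min (hc ▸ EReal.coe_le_coe_iff.2 hpc) (EReal.coe_le_coe_iff.2 (hsec i hi))
    _ ≤ benchmark k v := by
        refine sum_le_benchmark hk hv0 (fun i j hij => ?_) (fun i => EReal.toReal_nonneg (he0 i))
          (fun i => ?_) hU fun i hi => ?_
        · rw [← EReal.coe_le_coe_iff, hcoe, hcoe]
          exact min_le_min_right _ (hF y hy i j hij)
        · rw [← EReal.coe_le_coe_iff, hcoe]
          exact min_le_right _ _
        · obtain ⟨c, hc, hcv, -⟩ := hle i hi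
          rw [← EReal.coe_le_coe_iff, hcoe]
          exact (min_le_left _ _).trans (hc ▸ EReal.coe_le_coe_iff.2 hcv)

/-- If no winner is charged more than the second-highest valuation, the revenue is at most twice
the benchmark. -/
theorem sum_winners_optPrice_le (hk : 2 ≤ k) (hF : PointwiseOrdered F)
    (hv : ∀ i, v i ∈ (F i).supp) {W : Finset (Fin n)} (hW : W ∈ winnerSets F k v)
    (hsec : ∀ i ∈ W, optPrice F k v i ≤ secondHighest v) :
    ∑ i ∈ W, optPrice F k v i ≤ 2 * benchmark k v := by
  classical
  have hv0 : ∀ i, 0 ≤ v i := fun i => (ValueDist.pos_of_mem_supp (hv i)).le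
  have hM := benchmark_nonneg hk hv0
  rw [winnerSets_eq] at hW
  have hWk := card_le_of_mem_topSets hW
  have hpos : ∀ i ∈ W, 0 < share k (levels F v) i := fun i hi => share_pos_iff.2 ⟨W, hW, hi⟩
  have hlev : ∀ i ∈ W, 0 < (F i).ironed (v i) := fun i hi => by
    have := pos_of_share_pos (hpos i hi)
    rw [levels_of_mem (hv i)] at this
    exact EReal.coe_pos.1 this
  -- The factor 2 arises here: sure winners and lottery winners are charged to the benchmark
  -- separately, because lowering a bid to the tied level could turn a sure win into a lottery.
  rw [← Finset.sum_filter_add_sum_filter_not W fun i => share k (levels F v) i = 1, two_mul]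
  refine add_le_add ?_ ?_
  · set S := W.filter fun i => share k (levels F v) i = 1
    have hSW : ∀ i ∈ S, i ∈ W := fun i hi => (Finset.mem_filter.1 hi).1
    have hS1 : ∀ i ∈ S, share k (levels F v) i = 1 := fun i hi => (Finset.mem_filter.1 hi).2
    rcases S.eq_empty_or_nonempty with hS | hS
    · rw [hS, Finset.sum_empty]; exact hM
    obtain ⟨a, ha, hmin⟩ := Finset.exists_min_image S (fun i => (F i).ironed (v i)) hS
    refine sum_optPrice_le_benchmark hk hF hv (hlev a (hSW a ha)).le
      ((Finset.card_filter_le _ _).trans hWk) (fun i hi => ?_) hmin (fun i hi t ht _ hy => ?_)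
      fun i hi => hsec i (hSW i hi)
    · rw [optX_eq]; exact hpos i (hSW i hi)
    · rw [optX_update, share_update_eq_one (hS1 i hi) (hS1 a ha) (by
        rw [levels_of_mem (hv a), (F i).bidLevel_of_mem ht]
        exact EReal.coe_le_coe_iff.2 hy)]
      exact optX_le_one _ _ _ _
  · set T := W.filter fun i => ¬ share k (levels F v) i = 1
    have hTW : ∀ i ∈ T, i ∈ W := fun i hi => (Finset.mem_filter.1 hi).1
    have hT1 : ∀ i ∈ T, share k (levels F v) i < 1 := fun i hi =>
      (share_le_one _ _ _).lt_of_ne (Finset.mem_filter.1 hi).2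
    rcases T.eq_empty_or_nonempty with hT | ⟨a, ha⟩
    · rw [hT, Finset.sum_empty]; exact hM
    have heq : ∀ i ∈ T, (F i).ironed (v i) = (F a).ironed (v a) := fun i hi => by
      have := level_eq_of_share (hpos i (hTW i hi)) (hT1 i hi) (hpos a (hTW a ha)) (hT1 a ha)
      rw [levels_of_mem (hv i), levels_of_mem (hv a)] at this
      exact EReal.coe_eq_coe_iff.1 this
    refine sum_optPrice_le_benchmark hk hF hv (hlev a (hTW a ha)).le
      ((Finset.card_filter_le _ _).trans hWk) (fun i hi => ?_) (fun i hi => (heq i hi).ge)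
      (fun i hi t ht htv hy => ?_) fun i hi => hsec i (hTW i hi)
    · rw [optX_eq]; exact hpos i (hTW i hi)
    -- All lottery winners have the level `y`, so a lower bid of level at least `y` has the same
    -- level and leaves the lottery unchanged.
    · have hit : (F i).ironed t = (F i).ironed (v i) :=
        le_antisymm ((F i).monotoneOn_ironed ht (hv i) htv) ((heq i hi).trans_le hy)
      rw [optX_update, (F i).bidLevel_of_mem ht, hit, ← levels_of_mem (hv i),
        Function.update_eq_self, optX_eq]

end Opt

/-! ### Truthful auctions -/

/-- The payment that the allocation rule `X` determines, if a bid of zero pays nothing. -/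
def payment {n : ℕ} (X : (Fin n → ℝ) → Fin n → ℝ) (v : Fin n → ℝ) (i : Fin n) : ℝ :=
  v i * X v i - ∫ t in (0 : ℝ)..(v i), X (Function.update v i t) i

namespace Auction

variable {n k : ℕ} (A : Auction n k) {v : Fin n → ℝ}

theorem update_nonneg (hv : ∀ j, 0 ≤ v j) (i : Fin n) {t : ℝ} (ht : 0 ≤ t) (j : Fin n) :
    0 ≤ Function.update v i t j := by
  rcases eq_or_ne j i with rfl | h
  · simpa using ht
  · simpa [h] using hv j

theorem truthful_update (hv : ∀ j, 0 ≤ v j) (i : Fin n) {s t : ℝ} (hs : 0 ≤ s) (ht : 0 ≤ t) :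
    t * A.X (Function.update v i s) i - A.P (Function.update v i s) i
      ≤ t * A.X (Function.update v i t) i - A.P (Function.update v i t) i := by
  have := A.truthful _ (update_nonneg hv i ht) i s hs
  simpa using this

/-- Adding the two incentive constraints between `s` and `t` cancels the payments. -/
theorem monotoneOn_X (hv : ∀ j, 0 ≤ v j) (i : Fin n) :
    MonotoneOn (fun t => A.X (Function.update v i t) i) (Ici 0) := by
  intro s hs t ht hst
  rcases (hst : s ≤ t).eq_or_lt with rfl | hlt
  · exact le_rfl
  have h1 := A.truthful_update hv i hs ht
  have h2 := A.truthful_update hv i ht hs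
  have h3 : 0 ≤ (t - s) * (A.X (Function.update v i t) i - A.X (Function.update v i s) i) := by
    linarith
  exact sub_nonneg.1 (nonneg_of_mul_nonneg_right h3 (sub_pos.2 hlt))

theorem intervalIntegrable_X (hv : ∀ j, 0 ≤ v j) (i : Fin n) {b : ℝ} (hb : 0 ≤ b) :
    IntervalIntegrable (fun t => A.X (Function.update v i t) i) volume 0 b := by
  refine MonotoneOn.intervalIntegrable ((A.monotoneOn_X hv i).mono ?_)
  rw [uIcc_of_le hb]
  exact fun t ht => ht.1

/-- The utility of a truthful bidder is the integral of its winning probability. -/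
theorem integral_X_eq (hv : ∀ j, 0 ≤ v j) (i : Fin n) {b : ℝ} (hb : 0 ≤ b) :
    ∫ t in (0 : ℝ)..b, A.X (Function.update v i t) i
      = (b * A.X (Function.update v i b) i - A.P (Function.update v i b) i)
        - (0 * A.X (Function.update v i 0) i - A.P (Function.update v i 0) i) := by
  set x : ℝ → ℝ := fun t => A.X (Function.update v i t) i with hx
  set u : ℝ → ℝ := fun t => t * x t - A.P (Function.update v i t) i with hu
  have hmono : MonotoneOn x (Ici 0) := A.monotoneOn_X hv i
  -- Truthfulness says that the winning probability is a subgradient of the utility `u`.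
  have hle : ∀ s t, 0 ≤ s → 0 ≤ t → u s + x s * (t - s) ≤ u t := fun s t hs ht => by
    have := A.truthful_update hv i hs ht
    simp only [hu, hx]
    linarith
  have hx0 : ∀ t, 0 ≤ t → 0 ≤ x t := fun t ht => A.X_nonneg _ (update_nonneg hv i ht) i
  have hx1 : ∀ t, 0 ≤ t → x t ≤ 1 := fun t ht => A.X_le_one _ (update_nonneg hv i ht) i
  have hbound : ∀ s t, 0 ≤ s → 0 ≤ t → |u t - u s - x s * (t - s)| ≤ |x t - x s| * |t - s| := by
    intro s t hs ht
    have h1 := hle s t hs ht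
    have h2 := hle t s ht hs
    rw [abs_of_nonneg (by linarith), ← abs_mul]
    refine le_trans ?_ (le_abs_self _)
    linarith
  have hcont : ContinuousOn u (Icc 0 b) := by
    intro s hs
    refine tendsto_iff_dist_tendsto_zero.2 (squeeze_zero' (g := fun t => 2 * |t - s|)
      (Eventually.of_forall fun _ => dist_nonneg) ?_ ?_)
    · filter_upwards [self_mem_nhdsWithin] with t ht
      have h1 := hbound s t hs.1 ht.1
      have h2 : |x t - x s| ≤ 1 := abs_le.2 ⟨by linarith [hx0 t ht.1, hx1 s hs.1],
        by linarith [hx1 t ht.1, hx0 s hs.1]⟩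
      have h3 : |x s * (t - s)| ≤ |t - s| := by
        rw [abs_mul, abs_of_nonneg (hx0 s hs.1)]
        exact mul_le_of_le_one_left (abs_nonneg _) (hx1 s hs.1)
      have h4 : |x t - x s| * |t - s| ≤ |t - s| := mul_le_of_le_one_left (abs_nonneg _) h2
      have h5 := abs_add_le (u t - u s - x s * (t - s)) (x s * (t - s))
      rw [sub_add_cancel] at h5
      rw [Real.dist_eq]
      linarith
    · have : ContinuousWithinAt (fun t => 2 * |t - s|) (Icc 0 b) s :=
        Continuous.continuousWithinAt (by fun_prop)
      simpa [ContinuousWithinAt] using this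
  -- By `hbound`, `u` has derivative `x` at positive continuity points of `x`, and a monotone rule
  -- has only countably many discontinuities.
  have hcount := (ValueDist.monotone_comp_max hmono).countable_not_continuousAt
  refine integral_eq_of_hasDerivAt_off_countable_of_le u x hb hcount hcont (fun s hs => ?_)
    (A.intervalIntegrable_X hv i hb)
  obtain ⟨⟨hs0, hsb⟩, hsc⟩ := hs
  have hsc' : ContinuousAt x s := by
    have hc : ContinuousAt (fun t => x (max 0 t)) s := by
      by_contra h
      exact hsc h
    refine hc.congr ?_
    filter_upwards [lt_mem_nhds hs0] with t ht
    rw [max_eq_right (le_of_lt ht)]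
  rw [hasDerivAt_iff_isLittleO]
  refine Asymptotics.isLittleO_iff.2 fun c hc => ?_
  have hev : ∀ᶠ t in 𝓝 s, |x t - x s| < c := by
    have := Metric.tendsto_nhds.1 hsc' c hc
    simpa [Real.dist_eq] using this
  filter_upwards [hev, lt_mem_nhds hs0] with t ht ht0
  have := hbound s t hs0.le (le_of_lt ht0)
  rw [smul_eq_mul, mul_comm (t - s), Real.norm_eq_abs, Real.norm_eq_abs]
  exact this.trans (mul_le_mul_of_nonneg_right ht.le (abs_nonneg _))

/-- Individual rationality makes the payment at bid zero nonpositive; the rest is the envelope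
formula. -/
theorem P_le_payment (hv : ∀ j, 0 ≤ v j) (i : Fin n) : A.P v i ≤ payment A.X v i := by
  have h1 := A.integral_X_eq hv i (hv i)
  have h2 := A.rational _ (update_nonneg hv i le_rfl) i
  simp only [Function.update_self, zero_mul, Function.update_eq_self] at h1 h2
  rw [payment, h1]
  linarith

theorem P_le (hv : ∀ j, 0 ≤ v j) (i : Fin n) : A.P v i ≤ v i :=
  (A.rational v hv i).trans (mul_le_of_le_one_right (hv i) (A.X_le_one v hv i))

theorem measurable_revenue : Measurable A.revenue :=
  Finset.measurable_fun_sum _ fun i _ => A.measurable_P i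

end Auction

/-! ### The product prior -/

section Prior

variable {n : ℕ} (F : Fin n → ValueDist)

instance isProbabilityMeasure_priorLaw : IsProbabilityMeasure (priorLaw F) := by
  unfold priorLaw; infer_instance

theorem measurePreserving_eval_priorLaw (i : Fin n) :
    MeasurePreserving (Function.eval i) (priorLaw F) (F i).law :=
  measurePreserving_eval (fun i => (F i).law) i

theorem ae_priorLaw_mem_supp : ∀ᵐ v ∂priorLaw F, ∀ i, v i ∈ (F i).supp :=
  ae_all_iff.2 fun i =>
    (measurePreserving_eval_priorLaw F i).quasiMeasurePreserving.ae (F i).ae_mem_supp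

theorem ae_priorLaw_nonneg : ∀ᵐ v ∂priorLaw F, ∀ i, 0 ≤ v i := by
  filter_upwards [ae_priorLaw_mem_supp F] with v hv i using (ValueDist.pos_of_mem_supp (hv i)).le

theorem integrable_eval (i : Fin n) : Integrable (fun v => v i) (priorLaw F) :=
  (measurePreserving_eval_priorLaw F i).integrable_comp_of_integrable (F i).integrable_id_law

theorem integrable_ironed_eval (i : Fin n) :
    Integrable (fun v => (F i).ironed (v i)) (priorLaw F) :=
  (measurePreserving_eval_priorLaw F i).integrable_comp_of_integrable (F i).integrable_ironed

/-- Redrawing a coordinate does not change the law of the profile. -/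
theorem measurePreserving_update (i : Fin n) :
    MeasurePreserving (fun p : (Fin n → ℝ) × ℝ => Function.update p.1 i p.2)
      ((priorLaw F).prod (F i).law) (priorLaw F) := by
  have hm : Measurable fun p : (Fin n → ℝ) × ℝ => Function.update p.1 i p.2 := measurable_update'
  refine ⟨hm, ?_⟩
  refine (Measure.pi_eq fun s hs => ?_).symm
  rw [Measure.map_apply hm (MeasurableSet.univ_pi hs)]
  have hset : (fun p : (Fin n → ℝ) × ℝ => Function.update p.1 i p.2) ⁻¹' (univ.pi s)
      = (univ.pi (Function.update s i univ)) ×ˢ s i := by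
    ext p
    simp only [mem_preimage, Set.mem_pi, mem_univ, forall_true_left, mem_prod]
    constructor
    · refine fun h => ⟨fun j => ?_, by simpa using h i⟩
      rcases eq_or_ne j i with rfl | hj
      · simp
      · simpa [hj] using h j
    · rintro ⟨h, h'⟩ j
      rcases eq_or_ne j i with rfl | hj
      · simpa using h'
      · simpa [hj] using h j
  rw [hset, Measure.prod_prod, priorLaw, Measure.pi_pi,
    ← Finset.mul_prod_erase Finset.univ (fun j => (F j).law (s j)) (Finset.mem_univ i),
    ← Finset.mul_prod_erase Finset.univ _ (Finset.mem_univ i)]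
  rw [Function.update_self, measure_univ, one_mul, mul_comm]
  congr 1
  exact Finset.prod_congr rfl fun j hj => by rw [Function.update_of_ne (Finset.ne_of_mem_erase hj)]

theorem integral_priorLaw_eq (i : Fin n) {g : (Fin n → ℝ) → ℝ} (hg : Integrable g (priorLaw F)) :
    ∫ v, g v ∂priorLaw F
      = ∫ v, ∫ t, g (Function.update v i t) ∂(F i).law ∂priorLaw F := by
  have hmp := measurePreserving_update F i
  have h1 : ∫ v, g v ∂priorLaw F
      = ∫ p, g (Function.update p.1 i p.2) ∂((priorLaw F).prod (F i).law) := by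
    conv_lhs => rw [← hmp.map_eq]
    refine integral_map hmp.measurable.aemeasurable ?_
    rw [hmp.map_eq]; exact hg.aestronglyMeasurable
  rw [h1]
  exact integral_prod _ (hmp.integrable_comp_of_integrable hg)

end Prior

/-! ### Expected payments and ironed virtual surplus -/

section Surplus

variable {n : ℕ} {F : Fin n → ValueDist} {X : (Fin n → ℝ) → Fin n → ℝ} {i : Fin n}

/-- The moving endpoint is absorbed into an indicator on the product space, leaving a parametric
integral over a fixed domain. -/
theorem measurable_integral_update (hX : Measurable fun v => X v i) :
    Measurable fun v : Fin n → ℝ => ∫ t in (0 : ℝ)..(v i), X (Function.update v i t) i := by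
  have hu : Measurable fun p : (Fin n → ℝ) × ℝ => X (Function.update p.1 i p.2) i :=
    hX.comp measurable_update'
  have key : ∀ a b : (Fin n → ℝ) → ℝ, Measurable a → Measurable b →
      Measurable fun v => ∫ t in Ioc (a v) (b v), X (Function.update v i t) i := by
    intro a b ha hb
    have hs : MeasurableSet {p : (Fin n → ℝ) × ℝ | p.2 ∈ Ioc (a p.1) (b p.1)} :=
      (measurableSet_lt (ha.comp measurable_fst) measurable_snd).inter
        (measurableSet_le measurable_snd (hb.comp measurable_fst))
    have h := ((hu.indicator hs).stronglyMeasurable.integral_prod_right'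
      (ν := (volume : Measure ℝ))).measurable
    convert h using 2 with v
    rw [← integral_indicator measurableSet_Ioc]
    rfl
  simp only [intervalIntegral]
  exact (key _ _ measurable_const (measurable_pi_apply i)).sub
    (key _ _ (measurable_pi_apply i) measurable_const)

theorem measurable_payment (hX : Measurable fun v => X v i) : Measurable fun v => payment X v i :=
  ((measurable_pi_apply i).mul hX).sub (measurable_integral_update hX)

theorem abs_payment_le (h0 : ∀ v, (∀ j, 0 ≤ v j) → ∀ i, 0 ≤ X v i)
    (h1 : ∀ v, (∀ j, 0 ≤ v j) → ∀ i, X v i ≤ 1) {v : Fin n → ℝ} (hv : ∀ j, 0 ≤ v j) :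
    |payment X v i| ≤ 2 * v i := by
  have ha : |v i * X v i| ≤ v i := by
    rw [abs_of_nonneg (mul_nonneg (hv i) (h0 v hv i))]
    exact mul_le_of_le_one_right (hv i) (h1 v hv i)
  have hb := intervalIntegral.norm_integral_le_of_norm_le_const (a := 0) (b := v i)
    (f := fun t => X (Function.update v i t) i) (C := 1) fun t ht => by
      rw [uIoc_of_le (hv i)] at ht
      have hn := Auction.update_nonneg hv i ht.1.le
      rw [Real.norm_eq_abs, abs_of_nonneg (h0 _ hn i)]
      exact h1 _ hn i
  rw [sub_zero, one_mul, abs_of_nonneg (hv i), Real.norm_eq_abs] at hb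
  have := abs_sub (v i * X v i) (∫ t in (0 : ℝ)..(v i), X (Function.update v i t) i)
  rw [payment]
  linarith

theorem integrable_payment (h0 : ∀ v, (∀ j, 0 ≤ v j) → ∀ i, 0 ≤ X v i)
    (h1 : ∀ v, (∀ j, 0 ≤ v j) → ∀ i, X v i ≤ 1) (hX : Measurable fun v => X v i) :
    Integrable (fun v => payment X v i) (priorLaw F) := by
  refine ((integrable_eval F i).const_mul 2).mono' (measurable_payment hX).aestronglyMeasurable ?_
  filter_upwards [ae_priorLaw_nonneg F] with v hv using abs_payment_le h0 h1 hv

theorem integrable_ironed_mul (h0 : ∀ v, (∀ j, 0 ≤ v j) → ∀ i, 0 ≤ X v i)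
    (h1 : ∀ v, (∀ j, 0 ≤ v j) → ∀ i, X v i ≤ 1) (hX : Measurable fun v => X v i) :
    Integrable (fun v => (F i).ironed (v i) * X v i) (priorLaw F) := by
  refine (integrable_ironed_eval F i).mul_bdd (c := 1) hX.aestronglyMeasurable ?_
  filter_upwards [ae_priorLaw_nonneg F] with v hv
  rw [Real.norm_eq_abs, abs_of_nonneg (h0 v hv i)]
  exact h1 v hv i

/-- Redrawing coordinate `i` reduces the claim to a single bidder facing fixed bids of the others.
-/
theorem integral_ironed_sub_payment (h0 : ∀ v, (∀ j, 0 ≤ v j) → ∀ i, 0 ≤ X v i)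
    (h1 : ∀ v, (∀ j, 0 ≤ v j) → ∀ i, X v i ≤ 1) (hX : Measurable fun v => X v i) :
    ∫ v, (F i).ironed (v i) * X v i ∂priorLaw F - ∫ v, payment X v i ∂priorLaw F
      = ∫ v, ∫ t, (F i).gap (fun s => X (Function.update v i s) i) t ∂(F i).law ∂priorLaw F := by
  have hi1 := integrable_ironed_mul (F := F) h0 h1 hX
  have hi2 := integrable_payment (F := F) h0 h1 hX
  have h := integral_priorLaw_eq F i (hi1.sub hi2)
  simp only [Pi.sub_apply] at h
  rw [← integral_sub hi1 hi2, h]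
  simp [ValueDist.gap, payment]

theorem integral_payment_le (h0 : ∀ v, (∀ j, 0 ≤ v j) → ∀ i, 0 ≤ X v i)
    (h1 : ∀ v, (∀ j, 0 ≤ v j) → ∀ i, X v i ≤ 1) (hX : Measurable fun v => X v i)
    (hmono : ∀ v : Fin n → ℝ, (∀ j, 0 ≤ v j) →
      MonotoneOn (fun t => X (Function.update v i t) i) (Ici 0)) :
    ∫ v, payment X v i ∂priorLaw F ≤ ∫ v, (F i).ironed (v i) * X v i ∂priorLaw F := by
  rw [← sub_nonneg, integral_ironed_sub_payment h0 h1 hX]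
  refine integral_nonneg_of_ae ?_
  filter_upwards [ae_priorLaw_nonneg F] with v hv
  exact ValueDist.integral_gap_nonneg (hmono v hv)
    (fun t ht => h0 _ (Auction.update_nonneg hv i ht) i)
    (fun t ht => h1 _ (Auction.update_nonneg hv i ht) i)

end Surplus

/-! ### Measurability and optimality of the Bayesian optimal auction. -/

section Optimal

variable {n k : ℕ} {F : Fin n → ValueDist}

theorem measurableSet_mem_winnerSets (F : Fin n → ValueDist) (k : ℕ) (W : Finset (Fin n)) :
    MeasurableSet {v | W ∈ winnerSets F k v} := by
  classical
  have hL : ∀ i, Measurable fun v : Fin n → ℝ => levels F v i := fun i =>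
    (F i).measurable_bidLevel.comp (measurable_pi_apply i)
  have hcard : Measurable fun v : Fin n → ℝ =>
      (Finset.univ.filter fun i => 0 < levels F v i).card := by
    simp only [Finset.card_filter]
    exact Finset.measurable_fun_sum _ fun i _ =>
      Measurable.ite (measurableSet_lt measurable_const (hL i)) measurable_const measurable_const
  simp only [winnerSets_eq, mem_topSets]
  refine measurableSet_setOfPred.2 (Measurable.and ?_ (Measurable.and ?_ ?_))
  · exact Measurable.forall fun i => Measurable.forall fun _ =>
      measurableSet_setOfPred.1 (measurableSet_lt measurable_const (hL i))
  · exact measurableSet_setOfPred.1 (measurableSet_eq_fun measurable_const (measurable_const.min hcard))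
  · exact Measurable.forall fun i => Measurable.forall fun _ => Measurable.forall fun j =>
      Measurable.forall fun _ => measurableSet_setOfPred.1 (measurableSet_le (hL j) (hL i))

open Classical in
theorem measurable_sum_winnerSets {p : Finset (Fin n) → (Fin n → ℝ) → Prop}
    (hp : ∀ W, MeasurableSet {v | p W v}) {f : Finset (Fin n) → (Fin n → ℝ) → ℝ}
    (hf : ∀ W, Measurable (f W)) :
    Measurable fun v => ∑ W ∈ (winnerSets F k v).filter (fun W => p W v), f W v := by
  have : (fun v => ∑ W ∈ (winnerSets F k v).filter (fun W => p W v), f W v)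
      = fun v => ∑ W, if W ∈ winnerSets F k v ∧ p W v then f W v else 0 := by
    ext v
    rw [← Finset.sum_filter]
    congr 1
    ext W
    simp
  rw [this]
  exact Finset.measurable_fun_sum _ fun W _ =>
    Measurable.ite ((measurableSet_mem_winnerSets F k W).inter (hp W)) (hf W) measurable_const

theorem measurable_card_winnerSets (F : Fin n → ValueDist) (k : ℕ) :
    Measurable fun v => ((winnerSets F k v).card : ℝ) := by
  classical
  have := measurable_sum_winnerSets (F := F) (k := k) (p := fun _ _ => True) (f := fun _ _ => 1)
    (fun _ => by simp) fun _ => measurable_const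
  simpa using this

theorem measurable_optX (F : Fin n → ValueDist) (k : ℕ) (i : Fin n) :
    Measurable fun v => optX F k v i := by
  classical
  have := measurable_sum_winnerSets (F := F) (k := k) (p := fun W _ => i ∈ W) (f := fun _ _ => 1)
    (fun _ => MeasurableSet.const _) fun _ => measurable_const
  refine Measurable.div ?_ (measurable_card_winnerSets F k)
  convert this using 2 with v
  rw [Finset.sum_const, nsmul_eq_mul, mul_one]
  congr!

theorem optP_eq_payment (F : Fin n → ValueDist) (k : ℕ) : optP F k = payment (optX F k) := rfl

theorem measurable_optPrice (F : Fin n → ValueDist) (k : ℕ) (i : Fin n) :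
    Measurable fun v => optPrice F k v i :=
  (measurable_payment (measurable_optX F k i)).div (measurable_optX F k i)

theorem measurable_secondHighest : Measurable (secondHighest (n := n)) := by
  have : secondHighest (n := n) = fun v => ⨆ p : {p : Fin n × Fin n // p.1 ≠ p.2},
      min (v p.1.1) (v p.1.2) := by
    ext v
    rw [secondHighest, iSup]
    congr 1
    ext x
    constructor
    · rintro ⟨i, j, hij, rfl⟩; exact ⟨⟨(i, j), hij⟩, rfl⟩
    · rintro ⟨⟨⟨i, j⟩, hij⟩, rfl⟩; exact ⟨i, j, hij, rfl⟩
  rw [this]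
  exact Measurable.iSup fun p => (measurable_pi_apply _).min (measurable_pi_apply _)

theorem integrable_optP (F : Fin n → ValueDist) (k : ℕ) (i : Fin n) :
    Integrable (fun v => optP F k v i) (priorLaw F) :=
  integrable_payment (fun v _ i => optX_nonneg F k v i) (fun v _ i => optX_le_one F k v i)
    (measurable_optX F k i)

/-- A bid influences the allocation only through its level, so the gap integrates to zero for every
profile of the other bids. -/
theorem integral_optP (F : Fin n → ValueDist) (k : ℕ) (i : Fin n) :
    ∫ v, optP F k v i ∂priorLaw F = ∫ v, (F i).ironed (v i) * optX F k v i ∂priorLaw F := by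
  have h := integral_ironed_sub_payment (F := F) (fun v _ i => optX_nonneg F k v i)
    (fun v _ i => optX_le_one F k v i) (measurable_optX F k i)
  rw [optP_eq_payment, eq_comm, ← sub_eq_zero, h]
  refine integral_eq_zero_of_ae (ae_of_all _ fun v => ?_)
  refine ValueDist.integral_gap_eq_zero ((monotone_optX_update F k v i).monotoneOn _)
    (fun _ _ => optX_nonneg _ _ _ _) (fun _ _ => optX_le_one _ _ _ _)
    (fun t ht => optX_update_of_le_lo ht) fun a ha b hb hab => ?_
  rw [optX_update, optX_update, (F i).bidLevel_of_mem ha, (F i).bidLevel_of_mem hb, hab]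

theorem levels_eq_coe {v : Fin n → ℝ} (hv : ∀ i, v i ∈ (F i).supp) :
    levels F v = fun i => ((F i).ironed (v i) : EReal) :=
  funext fun i => levels_of_mem (hv i)

/-- Myerson's theorem: no truthful and individually rational auction has a higher expected revenue
than the Bayesian optimal auction. -/
theorem expectedRevenue_le_optRevenue (B : Auction n k)
    (hB : Integrable B.revenue (priorLaw F)) : expectedRevenue F B ≤ optRevenue F k := by
  have hpay := fun i => integrable_payment (F := F) B.X_nonneg B.X_le_one (B.measurable_X i)
  have hsur := fun i => integrable_ironed_mul (F := F) B.X_nonneg B.X_le_one (B.measurable_X i)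
  have hopt := fun i => integrable_ironed_mul (F := F) (fun v _ i => optX_nonneg F k v i)
    (fun v _ i => optX_le_one F k v i) (measurable_optX F k i)
  calc expectedRevenue F B ≤ ∫ v, ∑ i, payment B.X v i ∂priorLaw F := by
        refine integral_mono_ae hB (integrable_finsetSum _ fun i _ => hpay i) ?_
        filter_upwards [ae_priorLaw_nonneg F] with v hv
        exact Finset.sum_le_sum fun i _ => B.P_le_payment hv i
    _ = ∑ i, ∫ v, payment B.X v i ∂priorLaw F := integral_finsetSum _ fun i _ => hpay i
    _ ≤ ∑ i, ∫ v, (F i).ironed (v i) * B.X v i ∂priorLaw F :=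
        Finset.sum_le_sum fun i _ => integral_payment_le B.X_nonneg B.X_le_one (B.measurable_X i)
          fun v hv => B.monotoneOn_X hv i
    _ = ∫ v, ∑ i, (F i).ironed (v i) * B.X v i ∂priorLaw F :=
        (integral_finsetSum _ fun i _ => hsur i).symm
    -- The inequality holds profile by profile: selling to the highest positive levels maximizes the
    -- ironed virtual surplus.
    _ ≤ ∫ v, ∑ i, (F i).ironed (v i) * optX F k v i ∂priorLaw F := by
        refine integral_mono_ae (integrable_finsetSum _ fun i _ => hsur i)
          (integrable_finsetSum _ fun i _ => hopt i) ?_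
        filter_upwards [ae_priorLaw_mem_supp F] with v hv
        have hv0 : ∀ i, 0 ≤ v i := fun i => (ValueDist.pos_of_mem_supp (hv i)).le
        simp_rw [optX_eq, levels_eq_coe hv]
        exact sum_mul_le_sum_mul_share (B.X_nonneg v hv0) (B.X_le_one v hv0) (B.supply v hv0)
    _ = ∑ i, ∫ v, (F i).ironed (v i) * optX F k v i ∂priorLaw F :=
        integral_finsetSum _ fun i _ => hopt i
    _ = ∑ i, ∫ v, optP F k v i ∂priorLaw F := by simp_rw [integral_optP]
    _ = optRevenue F k := (integral_finsetSum _ fun i _ => integrable_optP F k i).symm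

/-! ### Optimal revenue against the benchmark. -/

open Classical in
/-- The expected revenue, over the random choice of the winners, from outcomes in which some winner
is charged more than the second-highest valuation. -/
def highPriceRevenue (F : Fin n → ValueDist) (k : ℕ) (v : Fin n → ℝ) : ℝ :=
  (∑ W ∈ (winnerSets F k v).filter (fun W => ∃ i ∈ W, secondHighest v < optPrice F k v i),
    ∑ i ∈ W, optPrice F k v i) / ((winnerSets F k v).card : ℝ)

theorem sum_optP_eq {v : Fin n → ℝ} (hv : ∀ i, 0 ≤ v i) :
    ∑ i, optP F k v i
      = (∑ W ∈ winnerSets F k v, ∑ i ∈ W, optPrice F k v i) / (winnerSets F k v).card := by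
  rw [winnerSets_eq, ← sum_share_mul]
  exact Finset.sum_congr rfl fun i _ => by rw [← optX_eq, optP_eq (hv i)]

theorem measurable_highPriceRevenue (F : Fin n → ValueDist) (k : ℕ) :
    Measurable (highPriceRevenue F k) := by
  have hp : ∀ W : Finset (Fin n),
      MeasurableSet {v | ∃ i ∈ W, secondHighest v < optPrice F k v i} := by
    intro W
    have : {v | ∃ i ∈ W, secondHighest v < optPrice F k v i}
        = ⋃ i ∈ W, {v | secondHighest v < optPrice F k v i} := by
      ext v; simp
    rw [this]
    exact MeasurableSet.biUnion (Set.to_countable _) fun i _ =>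
      measurableSet_lt measurable_secondHighest (measurable_optPrice F k i)
  have hnum := measurable_sum_winnerSets (F := F) (k := k)
    (p := fun W v => ∃ i ∈ W, secondHighest v < optPrice F k v i)
    (f := fun W v => ∑ i ∈ W, optPrice F k v i) hp fun W =>
      Finset.measurable_fun_sum _ fun i _ => measurable_optPrice F k i
  refine Measurable.div ?_ (measurable_card_winnerSets F k)
  convert hnum using 4

theorem highPriceRevenue_nonneg {v : Fin n → ℝ} (hv : ∀ i, 0 ≤ v i) :
    0 ≤ highPriceRevenue F k v :=
  div_nonneg (Finset.sum_nonneg fun _ _ => Finset.sum_nonneg fun i _ => optPrice_nonneg (hv i))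
    (Nat.cast_nonneg _)

theorem highPriceRevenue_le {v : Fin n → ℝ} (hv : ∀ i, 0 ≤ v i) :
    highPriceRevenue F k v ≤ ∑ i, optP F k v i := by
  rw [sum_optP_eq hv]
  exact div_le_div_of_nonneg_right (Finset.sum_le_sum_of_subset_of_nonneg
    (Finset.filter_subset _ _) fun _ _ _ => Finset.sum_nonneg fun i _ => optPrice_nonneg (hv i))
    (Nat.cast_nonneg _)

/-- The difference is an average over winner sets in which those with a high price count as zero and
each of the others collects at most twice the benchmark. -/
theorem sum_optP_sub_highPriceRevenue_le (hk : 2 ≤ k) (hF : PointwiseOrdered F) {v : Fin n → ℝ}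
    (hv : ∀ i, v i ∈ (F i).supp) :
    ∑ i, optP F k v i - highPriceRevenue F k v ≤ 2 * benchmark k v := by
  classical
  have hv0 : ∀ i, 0 ≤ v i := fun i => (ValueDist.pos_of_mem_supp (hv i)).le
  have hM := benchmark_nonneg hk hv0
  have hpos : (0 : ℝ) < (winnerSets F k v).card := card_topSets_pos k (levels F v)
  have hsplit := Finset.sum_filter_add_sum_filter_not (winnerSets F k v)
    (fun W => ∃ i ∈ W, secondHighest v < optPrice F k v i) fun W => ∑ i ∈ W, optPrice F k v i
  rw [sum_optP_eq hv0, highPriceRevenue, ← sub_div, div_le_iff₀ hpos, ← hsplit,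
    add_sub_cancel_left]
  calc _ ≤ ((winnerSets F k v).filter
          fun W => ¬ ∃ i ∈ W, secondHighest v < optPrice F k v i).card • (2 * benchmark k v) := by
        refine Finset.sum_le_card_nsmul _ _ _ fun W hW => ?_
        rw [Finset.mem_filter] at hW
        refine sum_winners_optPrice_le hk hF hv hW.1 fun i hi => ?_
        by_contra h
        exact hW.2 ⟨i, hi, not_le.1 h⟩
    _ ≤ 2 * benchmark k v * (winnerSets F k v).card := by
        rw [nsmul_eq_mul, mul_comm]
        exact mul_le_mul_of_nonneg_left (by exact_mod_cast Finset.card_filter_le _ _)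
          (by linarith)

theorem mul_optRevenue_le_expectedRevenue {α γ : ℝ} (hα : 0 < α) (hk : 2 ≤ k) (A : Auction n k)
    (hA : ∀ v : Fin n → ℝ, (∀ i, 0 ≤ v i) → α * benchmark k v ≤ A.revenue v)
    (hF : PointwiseOrdered F) (hγ : WellBehaved γ F k) :
    α * (1 - γ) / 2 * optRevenue F k ≤ expectedRevenue F A := by
  have hopt : Integrable (fun v => ∑ i, optP F k v i) (priorLaw F) :=
    integrable_finsetSum _ fun i _ => integrable_optP F k i
  have hhigh : Integrable (highPriceRevenue F k) (priorLaw F) := by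
    refine hopt.mono' (measurable_highPriceRevenue F k).aestronglyMeasurable ?_
    filter_upwards [ae_priorLaw_nonneg F] with v hv
    rw [Real.norm_eq_abs, abs_of_nonneg (highPriceRevenue_nonneg hv)]
    exact highPriceRevenue_le hv
  -- The benchmark guarantee supplies the lower bound zero; truthfulness and individual rationality
  -- alone allow arbitrarily large payments to bidders.
  have hrev : Integrable A.revenue (priorLaw F) := by
    refine (integrable_finsetSum Finset.univ fun i _ => integrable_eval F i).mono'
      A.measurable_revenue.aestronglyMeasurable ?_
    filter_upwards [ae_priorLaw_nonneg F] with v hv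
    have hnn := (mul_nonneg hα.le (benchmark_nonneg hk hv)).trans (hA v hv)
    rw [Real.norm_eq_abs, abs_of_nonneg hnn]
    exact Finset.sum_le_sum fun i _ => A.P_le hv i
  -- Both revenues are compared with the benchmark pointwise, so the benchmark itself is never
  -- integrated.
  have hmain : ∫ v, α / 2 * (∑ i, optP F k v i - highPriceRevenue F k v) ∂priorLaw F
      ≤ expectedRevenue F A := by
    refine integral_mono_ae ((hopt.sub hhigh).const_mul _) hrev ?_
    filter_upwards [ae_priorLaw_mem_supp F] with v hv
    have h1 := sum_optP_sub_highPriceRevenue_le hk hF hv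
    have h2 := hA v fun i => (ValueDist.pos_of_mem_supp (hv i)).le
    have h3 := mul_le_mul_of_nonneg_left h1 (half_pos hα).le
    linarith
  rw [integral_const_mul, integral_sub hopt hhigh] at hmain
  have hwb : ∫ v, highPriceRevenue F k v ∂priorLaw F
      ≤ γ * ∫ v, ∑ i, optP F k v i ∂priorLaw F := hγ
  have h3 := mul_le_mul_of_nonneg_left hwb (half_pos hα).le
  rw [optRevenue]
  linarith

theorem expectedRevenue_nonneg {α : ℝ} (hα : 0 < α) (hk : 2 ≤ k) (A : Auction n k)
    (hA : ∀ v : Fin n → ℝ, (∀ i, 0 ≤ v i) → α * benchmark k v ≤ A.revenue v) :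
    0 ≤ expectedRevenue F A := by
  refine integral_nonneg_of_ae ?_
  filter_upwards [ae_priorLaw_nonneg F] with v hv
  exact (mul_nonneg hα.le (benchmark_nonneg hk hv)).trans (hA v hv)

end Optimal

end PriorFree

end

/-- If an auction earns at least an `α` fraction of the benchmark on every input, then in every
environment that is well-behaved (with fraction `γ < 1`) and has pointwise ordered distributions, it
earns at least a fraction `c` of the revenue of the Bayesian optimal auction, and hence of every
truthful and individually rational auction, where `c` depends only on `α` and `γ`. -/
theorem theorem2 (α γ : ℝ) (hα : 0 < α) (hγ : γ < 1) :
    ∃ c : ℝ, 0 < c ∧ ∀ (n k : ℕ), 2 ≤ n → 2 ≤ k → ∀ A : PriorFree.Auction n k,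
      (∀ v : Fin n → ℝ, (∀ i, 0 ≤ v i) → α * PriorFree.benchmark k v ≤ A.revenue v) →
      ∀ F : Fin n → PriorFree.ValueDist,
        PriorFree.PointwiseOrdered F → PriorFree.WellBehaved γ F k →
        c * PriorFree.optRevenue F k ≤ PriorFree.expectedRevenue F A ∧
        ∀ B : PriorFree.Auction n k,
          c * PriorFree.expectedRevenue F B ≤ PriorFree.expectedRevenue F A := by
  have hc : 0 < α * (1 - γ) / 2 := half_pos (mul_pos hα (sub_pos.2 hγ))
  refine ⟨α * (1 - γ) / 2, hc, fun n k _ hk A hA F hF hwb => ?_⟩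
  have hmain := PriorFree.mul_optRevenue_le_expectedRevenue hα hk A hA hF hwb
  refine ⟨hmain, fun B => ?_⟩
  by_cases hB : MeasureTheory.Integrable B.revenue (PriorFree.priorLaw F)
  · exact (mul_le_mul_of_nonneg_left (PriorFree.expectedRevenue_le_optRevenue B hB) hc.le).trans
      hmain
  -- A revenue that is not integrable has expected revenue zero by the convention for integrals, so
  -- nonnegativity for `A` suffices.
  · rw [PriorFree.expectedRevenue, MeasureTheory.integral_undef hB, mul_zero]
    exact PriorFree.expectedRevenue_nonneg hα hk A hA
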